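/- **Setting.** A two-source two-destination layered network is a finite directed graph whose nodes are partitioned into layers $\mathcal L_0,\dots,\mathcal L_{L+1}$ ($L\ge 0$), every edge going from some $\mathcal L_k$ to $\mathcal L_{k+1}$, with $\mathcal L_0=\{s_1,s_2\}$ (two distinct sources) and $\mathcal L_{L+1}=\{d_1,d_2\}$ (two distinct destinations), such that every node can be reached from some source and can reach some destination. Every node transmits one bit per channel use, and a node that is not a source receives the XOR of the transmissions of its parents. In a block code of length $n$, source $s_i$ maps its message to $n$ bits, every other node maps its received block of $n$ bits to a transmitted block of $n$ bits by a fixed function, and $d_i$ estimates the message of $s_i$ from its received block. A pair $(R_1,R_2)$ with $R_1,R_2\ge 0$ is achievable if for every $\varepsilon>0$ and all sufficiently large $n$ there is a block code of length $n$ with at least $2^{nR_i}$ messages for user $i$ whose error probability (for independent uniform messages) is at most $\varepsilon$; the capacity region is the closure of the set of achievable pairs. Let $\mathfrak T=\{R_1,R_2\ge0,\ R_1+R_2\le1\}$ and $\mathfrak S=\{R_1,R_2\ge 0,\ R_1\le1,\ R_2\le1\}$. For a node $v$ that is not a source let $\mathcal P(v)$ be the set of its parents, $\mathcal P^{s_i}(v)$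 the set of its parents reachable from $s_i$ (every node reaches itself), $\mathcal K(v)$ the set of non-source nodes $u$ with $\mathcal P(u)=\mathcal P(v)$, and $\mathcal K^{s_i}(v)$ the set of non-source nodes $u$ with $\mathcal P^{s_i}(u)=\mathcal P^{s_i}(v)$. For a source $v$ put $\mathcal K(v)=\mathcal K^{s_i}(v)=\{v\}$. A set $\mathcal T$ of nodes is an $(\mathcal A;\mathcal B)$-vertex-cut if after deleting $\mathcal T$ no path leads from $\mathcal A\setminus\mathcal T$ to $\mathcal B\setminus\mathcal T$. A node $v$ is omniscient if (A) $\mathcal K(v)$ is an $(s_1,s_2;d_1)$-vertex-cut and $\mathcal K^{s_2}(v)$ is an $(s_2;d_2)$-vertex-cut, or (B) $\mathcal K(v)$ is an $(s_1,s_2;d_2)$-vertex-cut and $\mathcal K^{s_1}(v)$ is an $(s_1;d_1)$-vertex-cut. A critical node $v_i^*$ is any node of smallest possible layer index, denoted $k_i^*$, such that $\mathcal K(v_i^*)$ is an $(s_1,s_2;d_i)$-vertex-cut. In a scalar linear scheme over $\mathbb F_{2^r}$, source $s_i$ has one symbol $x_i\in\mathbb F_{2^r}$ and transmits $\alpha_{s_i}x_i$,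 and every other node $v$ that is not a destination transmits $\alpha_v$ times its reception (the sum in $\mathbb F_{2^r}$ of its parents' transmissions); it achieves $(1,1)$ if each $d_i$ can recover $x_i$ from its reception. A node performs random linear coding if its coefficient is uniform in $\mathbb F_{2^r}$; the coefficients of all nodes that do so are independent. "With high probability" means with probability tending to $1$ as $r\to\infty$. **Lemma.** Suppose that $s_i$ can reach $d_i$ for $i=1,2$. Then $k_1^*=0$ if and only if $s_2$ cannot reach $d_1$. Suppose moreover that $s_2$ cannot reach $d_1$. Then: 1. If the network has an omniscient node, its capacity region is $\mathfrak T$. If it has none, its capacity region is $\mathfrak S$, and the pair $(1,1)$ itself is achievable. For every critical node $v_2^*$, the network has an omniscient node if and only if $v_2^*$ is omniscient. 2. If $k_2^*=0$, then $(1,1)$ is achieved with high probability when all nodes perform random linear coding over $\mathbb F_{2^r}$. 3. If $k_2^*>0$ and there is no omniscient node, then for every critical node $v_2^*$, $(1,1)$ is achieved with high probability when all nodes outside $\mathcal P(v_2^*)$ perform random linear coding over $\mathbb F_{2^r}$ and the nodes of $\mathcal P(v_2^*)$ use suitable coefficients that are functions of the random coefficients of the nodes in earlier layers. -/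

import Mathlib

open Filter Topology

/-- A two-source two-destination layered network with node set `V`: a directed graph whose nodes
are arranged in layers `0, …, L + 1`, every edge going from a layer to the next one. Layer `0`
consists of the two (distinct) sources `s 0, s 1` and layer `L + 1` of the two (distinct)
destinations `d 0, d 1`. Every node can be reached from some source and can reach some
destination. (User `1` of the usual notation has index `0`, user `2` has index `1`.) -/
structure LayeredNetwork (V : Type*) where
  L : ℕ
  layer : V → ℕ
  edge : V → V → Prop
  s : Fin 2 → V
  d : Fin 2 → V
  s_injective : Function.Injective s
  d_injective : Function.Injective d
  layer_le : ∀ v, layer v ≤ L + 1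
  layer_eq_zero_iff : ∀ v, layer v = 0 ↔ v ∈ Set.range s
  layer_eq_last_iff : ∀ v, layer v = L + 1 ↔ v ∈ Set.range d
  layer_of_edge : ∀ u v, edge u v → layer v = layer u + 1
  reached : ∀ v, ∃ i, Relation.ReflTransGen edge (s i) v
  reaches : ∀ v, ∃ i, Relation.ReflTransGen edge v (d i)

namespace LayeredNetwork

variable {V : Type*} (N : LayeredNetwork V)

/-- There is a directed path (possibly of length zero) from `u` to `v`. -/
def Reaches (u v : V) : Prop := Relation.ReflTransGen N.edge u v

/-- The set `P(v)` of parents of `v`. -/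
def parents (v : V) : Set V := {u | N.edge u v}

/-- The set of parents of `v` that are reachable from the source `s i`. -/
def parentsFrom (i : Fin 2) (v : V) : Set V := {u | N.edge u v ∧ N.Reaches (N.s i) u}

def IsSource (v : V) : Prop := v ∈ Set.range N.s

/-- The clones `K(v)` of `v`. The parent sets are only meaningful for nodes other than the
sources, so a source is a clone of itself only. -/
def clones (v : V) : Set V :=
  {u | u = v ∨ (¬ N.IsSource u ∧ ¬ N.IsSource v ∧ N.parents u = N.parents v)}

/-- The `s i`-clones of `v`: the nodes with the same `s i`-reachable parents as `v`
(again a source is a clone of itself only). -/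
def clonesFrom (i : Fin 2) (v : V) : Set V :=
  {u | u = v ∨ (¬ N.IsSource u ∧ ¬ N.IsSource v ∧ N.parentsFrom i u = N.parentsFrom i v)}

/-- `T` is a `(A; B)`-vertex-cut: after deleting the nodes of `T` there is no path from a node of
`A \ T` to a node of `B \ T`. -/
def IsVertexCut (T A B : Set V) : Prop :=
  ∀ a ∈ A \ T, ∀ b ∈ B \ T,
    ¬ Relation.ReflTransGen (fun u w => N.edge u w ∧ u ∉ T ∧ w ∉ T) a b

/-- Omniscient nodes. -/
def IsOmniscient (v : V) : Prop :=
  (N.IsVertexCut (N.clones v) {N.s 0, N.s 1} {N.d 0} ∧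
      N.IsVertexCut (N.clonesFrom 1 v) {N.s 1} {N.d 1}) ∨
  (N.IsVertexCut (N.clones v) {N.s 0, N.s 1} {N.d 1} ∧
      N.IsVertexCut (N.clonesFrom 0 v) {N.s 0} {N.d 0})

/-- The smallest index `k` of a layer with a node `v` whose clones form a
`(s 0, s 1; d i)`-vertex-cut. -/
noncomputable def criticalLayer (i : Fin 2) : ℕ :=
  sInf {k | ∃ v, N.layer v = k ∧ N.IsVertexCut (N.clones v) {N.s 0, N.s 1} {N.d i}}

/-- `v` is a critical node for the destination `d i`. -/
def IsCritical (i : Fin 2) (v : V) : Prop :=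
  N.IsVertexCut (N.clones v) {N.s 0, N.s 1} {N.d i} ∧ N.layer v = N.criticalLayer i

theorem isVertexCut_clones_dest (i : Fin 2) :
    N.IsVertexCut (N.clones (N.d i)) {N.s 0, N.s 1} {N.d i} := by
  rintro a - b ⟨hb, hb'⟩
  exact absurd (Or.inl hb) hb'

theorem exists_isCritical (i : Fin 2) : ∃ v, N.IsCritical i v := by
  obtain ⟨v, hv, hcut⟩ := Nat.sInf_mem (s := {k | ∃ v, N.layer v = k ∧
    N.IsVertexCut (N.clones v) {N.s 0, N.s 1} {N.d i}})
    ⟨_, N.d i, rfl, N.isVertexCut_clones_dest i⟩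
  exact ⟨v, hcut, hv⟩

section Signals

variable [Fintype V] {M : Type*} [AddCommMonoid M]

open Classical in
/-- The signal sent by each node, if the source `s i` sends `x i` and every other node `v` sends
`f v y`, where `y` is its reception, the sum of the signals sent by its parents. -/
noncomputable def transmission (x : Fin 2 → M) (f : V → M → M) (v : V) : M :=
  if v = N.s 0 then x 0
  else if v = N.s 1 then x 1
  else f v (∑ u : {u // N.edge u v}, transmission x f u.1)
termination_by N.layer v
decreasing_by
  have := N.layer_of_edge u.1 v u.2
  omega

open Classical in
/-- The signal received by each node: the sum of the signals sent by its parents. -/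
noncomputable def reception (x : Fin 2 → M) (f : V → M → M) (v : V) : M :=
  ∑ u : {u // N.edge u v}, N.transmission x f u.1

end Signals

section Capacity

/-- A block code of length `n` with `m i` messages for user `i`. The channel input and output of
a node over the block are vectors of `n` bits; receptions are bitwise XORs of the transmissions of
the parents. -/
structure BlockCode (V : Type*) (n : ℕ) (m : Fin 2 → ℕ) where
  encoder : (i : Fin 2) → Fin (m i) → (Fin n → ZMod 2)
  relay : V → (Fin n → ZMod 2) → (Fin n → ZMod 2)
  decoder : (i : Fin 2) → (Fin n → ZMod 2) → Fin (m i)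

variable [Fintype V]

/-- The message that the destination `d i` decodes if the messages `w` are sent. -/
noncomputable def decoded {n : ℕ} {m : Fin 2 → ℕ} (c : BlockCode V n m)
    (w : (i : Fin 2) → Fin (m i)) (i : Fin 2) : Fin (m i) :=
  c.decoder i (N.reception (fun j => c.encoder j (w j)) c.relay (N.d i))

/-- The probability that some destination decodes its message wrongly, for independent uniformly
distributed messages. -/
noncomputable def errorProbability {n : ℕ} {m : Fin 2 → ℕ} (c : BlockCode V n m) : ℝ :=
  (Nat.card {w : (i : Fin 2) → Fin (m i) // ∃ i, N.decoded c w i ≠ w i} : ℝ) /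
    Nat.card ((i : Fin 2) → Fin (m i))

/-- The rate pair `R` (in bits per channel use) is achievable: for large block lengths there are
codes with at least `2 ^ (n R_i)` messages for user `i` and arbitrarily small error probability. -/
def Achievable (R : ℝ × ℝ) : Prop :=
  0 ≤ R.1 ∧ 0 ≤ R.2 ∧ ∀ ε : ℝ, 0 < ε → ∃ n₀ : ℕ, ∀ n : ℕ, n₀ ≤ n →
    ∃ (m : Fin 2 → ℕ) (c : BlockCode V n m),
      (2 : ℝ) ^ ((n : ℝ) * R.1) ≤ m 0 ∧ (2 : ℝ) ^ ((n : ℝ) * R.2) ≤ m 1 ∧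
        N.errorProbability c ≤ ε

/-- The capacity region: the closure of the set of achievable rate pairs. -/
def capacityRegion : Set (ℝ × ℝ) := closure {R | N.Achievable R}

end Capacity

section LinearCoding

variable [Fintype V]

/-- The scalar linear scheme over `F` with coding coefficients `α` conveys one symbol of `F` from
each source to its destination: source `s i` with symbol `x i` sends `α (s i) * x i`, any other
node `v` sends `α v` times its reception, and `d i` can recover `x i` from its reception. (The
coefficients of the destinations play no role.) -/
def LinearSchemeDecodes {F : Type*} [Field F] (α : V → F) : Prop :=
  ∃ D : Fin 2 → F → F, ∀ (x : Fin 2 → F) (i : Fin 2),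
    D i (N.reception (fun j => α (N.s j) * x j) (fun v y => α v * y) (N.d i)) = x i

open Classical in
/-- The rate pair `(1, 1)` is achieved with high probability when all nodes outside `S` perform
random linear coding over `𝔽_{2^r}`: they choose independent uniform coefficients `α`, the nodes of
`S` use coefficients `σ r α` that depend only on the random coefficients of earlier
layers, and the probability that one symbol per user is conveyed tends to `1` as `r → ∞`. -/
def RandomLinearCodingAchievesOneOne (S : Set V) : Prop :=
  ∃ σ : (r : ℕ) → (V → GaloisField 2 r) → V → GaloisField 2 r,
    (∀ (r : ℕ) (v : V) (α α' : V → GaloisField 2 r),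
      (∀ u, u ∉ S → N.layer u < N.layer v → α u = α' u) → σ r α v = σ r α' v) ∧
    Tendsto (fun r : ℕ =>
      (Nat.card {α : V → GaloisField 2 r //
          N.LinearSchemeDecodes (fun v => if v ∈ S then σ r α v else α v)} : ℝ) /
        Nat.card (V → GaloisField 2 r)) atTop (𝓝 1)

end LinearCoding

end LayeredNetwork

/-- The triangular rate region. -/
def triangleRegion : Set (ℝ × ℝ) := {R | 0 ≤ R.1 ∧ 0 ≤ R.2 ∧ R.1 + R.2 ≤ 1}

/-- The square rate region. -/
def squareRegion : Set (ℝ × ℝ) := {R | 0 ≤ R.1 ∧ 0 ≤ R.2 ∧ R.1 ≤ 1 ∧ R.2 ≤ 1}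

/-! Converse. Let `v` be omniscient, with its clones cutting both sources from `d i`. All clones
receive what `v` receives, so the block at `v` determines the reception of `d i` and hence message
`i`. Given that message, the parents not reached by the other source `s j` are known, so the block
also determines the reception of every `s j`-clone and hence of `d j` (`reception_eq_of_cuts`). Thus
`n` bits identify both messages, and the sum rate is at most one. Time sharing along two paths
attains the triangle.

Achievability of `(1, 1)`. Coefficients are taken as polynomials over `𝔽₂` in indeterminates. By
Schwartz–Zippel it suffices that the two direct gains are nonzero polynomials and the two cross
gains are zero (`randomLinearCoding_of_polynomial`). The cross gain at `d 0` is zero because `s 1`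
does not reach it. If `s 0` does not reach `d 1`, nothing more is needed.

Otherwise let `v` be critical for `d 1` and not omniscient. Minimality of its layer forces each
earlier layer to carry two independent signals towards `v` (`IsCritical.exists_genericDet_ne_zero`),
so its parents can cancel symbol `0` at `v` and keep symbol `1`. The clones of `v` cut off `d 1`,
which is then free of interference. Non-omniscience gives a path from `s 0` to `d 0` that meets the
layer of `v` at a node `w` whose `s 0`-reachable parents differ from those of `v`. This difference
lets symbol `0` survive at `w` (`exists_neutralizing_coefficients`), and random coefficients carry
it on to `d 0`.

The test at one critical node follows indirectly: if that node is not omniscient, `(1, 1)` is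
achievable, and the converse excludes every omniscient node. -/

namespace LayeredNetwork

variable {V : Type*} {N : LayeredNetwork V}

/-! ### Paths, layers, vertex cuts and clones -/

section Graph

theorem layer_source (i : Fin 2) : N.layer (N.s i) = 0 :=
  (N.layer_eq_zero_iff _).2 ⟨i, rfl⟩

theorem layer_dest (i : Fin 2) : N.layer (N.d i) = N.L + 1 :=
  (N.layer_eq_last_iff _).2 ⟨i, rfl⟩

theorem isSource_iff {v : V} : N.IsSource v ↔ N.layer v = 0 :=
  (N.layer_eq_zero_iff v).symm

theorem not_isSource_dest (i : Fin 2) : ¬ N.IsSource (N.d i) := by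
  rw [isSource_iff, layer_dest]; omega

theorem not_isSource_of_edge {u v : V} (h : N.edge u v) : ¬ N.IsSource v := by
  rw [isSource_iff, N.layer_of_edge u v h]; omega

theorem not_edge_source {u : V} (i : Fin 2) : ¬ N.edge u (N.s i) :=
  fun h => not_isSource_of_edge h ⟨i, rfl⟩

theorem Reaches.layer_le {u v : V} (h : N.Reaches u v) : N.layer u ≤ N.layer v := by
  induction h with
  | refl => rfl
  | tail _ h ih => have := N.layer_of_edge _ _ h; omega

theorem Reaches.eq_of_layer_eq {u v : V} (h : N.Reaches u v) (hl : N.layer v ≤ N.layer u) :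
    u = v := by
  rcases Relation.ReflTransGen.cases_tail h with h | ⟨c, hc, he⟩
  · exact h.symm
  · have := Reaches.layer_le (N := N) hc
    have := N.layer_of_edge _ _ he
    omega

theorem Reaches.source_eq {i : Fin 2} {u : V} (h : N.Reaches u (N.s i)) : u = N.s i :=
  h.eq_of_layer_eq (by rw [layer_source]; exact Nat.zero_le _)

/-- A path that crosses a layer has a node in it. -/
theorem exists_mem_layer_of_path {r : V → V → Prop} (hr : ∀ u v, r u v → N.edge u v) {a b : V}
    (h : Relation.ReflTransGen r a b) {m : ℕ} (ha : N.layer a ≤ m) (hb : m ≤ N.layer b) :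
    ∃ c, N.layer c = m ∧ Relation.ReflTransGen r a c ∧ Relation.ReflTransGen r c b := by
  induction h with
  | refl => exact ⟨a, by omega, .refl, .refl⟩
  | @tail b c h hbc ih =>
    have := N.layer_of_edge _ _ (hr _ _ hbc)
    by_cases hm : m ≤ N.layer b
    · obtain ⟨e, he, h1, h2⟩ := ih hm
      exact ⟨e, he, h1, h2.tail hbc⟩
    · exact ⟨c, by omega, h.tail hbc, .refl⟩

theorem reaches_of_avoiding {T : Set V} {a b : V}
    (h : Relation.ReflTransGen (fun u w => N.edge u w ∧ u ∉ T ∧ w ∉ T) a b) : N.Reaches a b :=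
  Relation.ReflTransGen.mono (p := N.edge) (fun _ _ h => h.1) _ _ h

theorem notMem_of_avoiding {T : Set V} {a b : V} (ha : a ∉ T)
    (h : Relation.ReflTransGen (fun u w => N.edge u w ∧ u ∉ T ∧ w ∉ T) a b) : b ∉ T := by
  rcases Relation.ReflTransGen.cases_tail h with h | ⟨c, -, he⟩
  · rwa [h]
  · exact he.2.2

/-- A property that passes from the parents of a node to the node, that holds on a vertex cut and
at the sources whose paths the cut does not block, holds behind the cut. -/
theorem IsVertexCut.induction {T A : Set V} {b : V} (hcut : N.IsVertexCut T A {b})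
    {P : V → Prop} (hT : ∀ u ∈ T, P u) (hs : ∀ i, N.s i ∉ A → P (N.s i))
    (hstep : ∀ v, ¬ N.IsSource v → (∀ u, N.edge u v → P u) → P v) : P b := by
  by_cases hb : b ∈ T
  · exact hT b hb
  -- The claim is restricted to nodes that still have a path to `b` avoiding `T`; for these the cut
  -- rules out every source in `A`.
  have key : ∀ k, ∀ w, N.layer w = k → w ∉ T →
      Relation.ReflTransGen (fun u w => N.edge u w ∧ u ∉ T ∧ w ∉ T) w b → P w := by
    intro k
    induction k using Nat.strong_induction_on with
    | _ k ih =>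
      intro w hw hwT hwb
      by_cases hsrc : N.IsSource w
      · obtain ⟨i, rfl⟩ := hsrc
        exact hs i fun hA => hcut _ ⟨hA, hwT⟩ b ⟨rfl, hb⟩ hwb
      · refine hstep w hsrc fun u hu => ?_
        by_cases huT : u ∈ T
        · exact hT u huT
        · have := N.layer_of_edge u w hu
          exact ih (N.layer u) (by omega) u rfl huT (.head ⟨hu, huT, hwT⟩ hwb)
  exact key _ b rfl hb .refl

/-- Every path from a source to a node crosses each vertex cut that separates them. -/
theorem IsVertexCut.exists_mem {T A : Set V} {b : V} (hcut : N.IsVertexCut T A {b}) {i : Fin 2}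
    (hi : N.s i ∈ A) (hb : N.Reaches (N.s i) b) :
    ∃ u ∈ T, N.Reaches (N.s i) u ∧ N.Reaches u b := by
  refine hcut.induction (P := fun w => N.Reaches (N.s i) w →
    ∃ u ∈ T, N.Reaches (N.s i) u ∧ N.Reaches u w) (fun u hu h => ⟨u, hu, h, .refl⟩) ?_ ?_ hb
  · intro j hj h
    exact absurd (h.source_eq ▸ hi) hj
  · intro v hv ih h
    rcases Relation.ReflTransGen.cases_tail h with h | ⟨c, hc, he⟩
    · exact absurd ⟨i, h.symm⟩ hv
    · obtain ⟨u, hu, h1, h2⟩ := ih c he hc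
      exact ⟨u, hu, h1, h2.tail he⟩

/-- A set that separates `A` from each node of a cut separates `A` from what is behind the cut. -/
theorem IsVertexCut.trans {T T' A : Set V} {b : V} (hcut : N.IsVertexCut T A {b})
    (hA : ∀ a ∈ A, N.IsSource a) (h : ∀ t ∈ T, N.IsVertexCut T' A {t}) :
    N.IsVertexCut T' A {b} := by
  refine hcut.induction (P := fun w => N.IsVertexCut T' A {w}) h ?_ ?_
  · rintro i hi a ⟨ha, -⟩ b ⟨rfl, -⟩ hab
    exact hi ((reaches_of_avoiding hab).source_eq ▸ ha)
  · rintro v hv ih a ⟨ha, haT⟩ b ⟨rfl, hb⟩ hab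
    rcases Relation.ReflTransGen.cases_tail hab with h | ⟨c, hc, he⟩
    · exact hv (h ▸ hA a ha)
    · exact ih c he.1 a ⟨ha, haT⟩ c ⟨rfl, he.2.1⟩ hc

theorem exists_edge_of_not_isSource {v : V} {i : Fin 2} (h : N.Reaches (N.s i) v)
    (hv : ¬ N.IsSource v) : ∃ u, N.edge u v ∧ N.Reaches (N.s i) u := by
  rcases Relation.ReflTransGen.cases_tail h with h | ⟨c, hc, he⟩
  · exact absurd ⟨i, h.symm⟩ hv
  · exact ⟨c, he, hc⟩

theorem exists_child {u v : V} (h : N.Reaches u v) (hl : N.layer u < N.layer v) :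
    ∃ w, N.edge u w ∧ N.Reaches w v := by
  rcases Relation.ReflTransGen.cases_head h with rfl | h
  · exact absurd hl (lt_irrefl _)
  · exact h

theorem parents_eq_of_mem_clones {u v : V} (h : u ∈ N.clones v) : N.parents u = N.parents v := by
  rcases h with rfl | h
  · rfl
  · exact h.2.2

theorem edge_iff_of_mem_clones {u v w : V} (h : u ∈ N.clones v) : N.edge w u ↔ N.edge w v :=
  Set.ext_iff.1 (parents_eq_of_mem_clones h) w

theorem not_isSource_of_mem_clones {u v : V} (h : u ∈ N.clones v) (hv : ¬ N.IsSource v) :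
    ¬ N.IsSource u := by
  rcases h with rfl | h
  · exact hv
  · exact h.1

theorem not_isSource_of_mem_clonesFrom {i : Fin 2} {u v : V} (h : u ∈ N.clonesFrom i v)
    (hv : ¬ N.IsSource v) : ¬ N.IsSource u := by
  rcases h with rfl | h
  · exact hv
  · exact h.1

theorem parentsFrom_eq_of_mem_clonesFrom {i : Fin 2} {u v : V} (h : u ∈ N.clonesFrom i v) :
    N.parentsFrom i u = N.parentsFrom i v := by
  rcases h with rfl | h
  · rfl
  · exact h.2.2

theorem layer_eq_of_mem_clones {u v : V} (h : u ∈ N.clones v) : N.layer u = N.layer v := by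
  rcases h with rfl | ⟨hu, -, hp⟩
  · rfl
  · obtain ⟨i, hi⟩ := N.reached u
    obtain ⟨w, hw, -⟩ := exists_edge_of_not_isSource hi hu
    rw [N.layer_of_edge w u hw, N.layer_of_edge w v ((Set.ext_iff.1 hp w).1 hw)]

theorem clones_source (i : Fin 2) : N.clones (N.s i) = {N.s i} := by
  ext u
  simp only [clones, Set.mem_ofPred_eq, Set.mem_singleton_iff, or_iff_left_iff_imp]
  exact fun h => absurd ⟨i, rfl⟩ h.2.1

theorem clonesFrom_source (i j : Fin 2) : N.clonesFrom i (N.s j) = {N.s j} := by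
  ext u
  simp only [clonesFrom, Set.mem_ofPred_eq, Set.mem_singleton_iff, or_iff_left_iff_imp]
  exact fun h => absurd ⟨j, rfl⟩ h.2.1

theorem source_mem_pair (i : Fin 2) : N.s i ∈ ({N.s 0, N.s 1} : Set V) := by
  fin_cases i <;> simp

/-- `d i` has a critical node in the source layer exactly if it cannot be reached from the other
source. -/
theorem criticalLayer_eq_zero_iff {i j : Fin 2} (hij : i ≠ j)
    (hi : N.Reaches (N.s i) (N.d i)) :
    N.criticalLayer i = 0 ↔ ¬ N.Reaches (N.s j) (N.d i) := by
  constructor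
  · intro h hj
    obtain ⟨v, hcut, hv⟩ := N.exists_isCritical i
    rw [h, ← isSource_iff] at hv
    obtain ⟨m, rfl⟩ := hv
    rw [clones_source] at hcut
    have key : ∀ l, N.Reaches (N.s l) (N.d i) → l = m := by
      intro l hl
      obtain ⟨u, rfl, hu, -⟩ := hcut.exists_mem (source_mem_pair l) hl
      exact N.s_injective hu.source_eq
    exact hij ((key i hi).trans (key j hj).symm)
  · intro h
    refine Nat.eq_zero_of_le_zero (Nat.sInf_le ⟨N.s i, layer_source i, ?_⟩)
    rw [clones_source]
    rintro a ⟨ha, ha'⟩ b ⟨rfl, -⟩ hab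
    have : a = N.s j := by
      simp only [Set.mem_insert_iff, Set.mem_singleton_iff] at ha ha'
      fin_cases i <;> fin_cases j <;> simp_all
    exact h (this ▸ reaches_of_avoiding hab)

/-- Strong induction along the layers: a property of a source and of each node whose parents have
it is a property of all nodes. -/
theorem layer_induction (N : LayeredNetwork V) {P : V → Prop} (hs : ∀ i, P (N.s i))
    (hstep : ∀ v, ¬ N.IsSource v → (∀ u, N.edge u v → P u) → P v) (v : V) : P v := by
  induction h : N.layer v using Nat.strong_induction_on generalizing v with
  | _ k ih =>
    by_cases hv : N.IsSource v
    · obtain ⟨i, rfl⟩ := hv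
      exact hs i
    · refine hstep v hv fun u hu => ih _ ?_ u rfl
      have := N.layer_of_edge u v hu
      omega

end Graph

/-! ### Transfer coefficients of linear schemes -/

section Gain

variable [Fintype V] {M : Type*} [AddCommMonoid M]

open Classical in
theorem transmission_of_not_isSource (x : Fin 2 → M) (f : V → M → M) {v : V}
    (hv : ¬ N.IsSource v) : N.transmission x f v = f v (N.reception x f v) := by
  rw [transmission, if_neg (fun h => hv ⟨0, h.symm⟩), if_neg (fun h => hv ⟨1, h.symm⟩), reception]

theorem transmission_source (x : Fin 2 → M) (f : V → M → M) (i : Fin 2) :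
    N.transmission x f (N.s i) = x i := by
  rw [transmission]
  fin_cases i
  · simp
  · simp [N.s_injective.eq_iff]

open Classical in
theorem reception_eq_sum_ite (x : Fin 2 → M) (f : V → M → M) (v : V) :
    N.reception x f v = ∑ u, if N.edge u v then N.transmission x f u else 0 := by
  rw [reception, ← Finset.sum_filter]
  exact (Finset.sum_subtype _ (fun u => Finset.mem_filter_univ u) (N.transmission x f)).symm

variable {R : Type*} [CommSemiring R]

open Classical in
/-- The coefficient of the source `s i` in the reception of a node when the nodes scale their
receptions by `g`; a source is regarded as receiving its own symbol. -/
noncomputable def gain (N : LayeredNetwork V) (g : V → R) (i : Fin 2) (v : V) : R :=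
  if v = N.s i then 1
  else ∑ u : {u // N.edge u v}, g u.1 * gain N g i u.1
termination_by N.layer v
decreasing_by
  have := N.layer_of_edge u.1 v u.2
  omega

theorem gain_source_self (g : V → R) (i : Fin 2) : N.gain g i (N.s i) = 1 := by
  rw [gain, if_pos rfl]

open Classical in
theorem gain_of_not_isSource (g : V → R) (i : Fin 2) {v : V} (hv : ¬ N.IsSource v) :
    N.gain g i v = ∑ u, if N.edge u v then g u * N.gain g i u else 0 := by
  rw [gain, if_neg (fun h => hv ⟨i, h.symm⟩), ← Finset.sum_filter]
  exact (Finset.sum_subtype _ (fun u => Finset.mem_filter_univ u)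
    (fun u => g u * N.gain g i u)).symm

theorem gain_eq_zero_of_not_reaches (g : V → R) {i : Fin 2} {v : V}
    (h : ¬ N.Reaches (N.s i) v) : N.gain g i v = 0 := by
  induction v using N.layer_induction with
  | hs j =>
    rw [gain, if_neg (fun hj : N.s j = N.s i => h (hj ▸ .refl))]
    exact Finset.sum_eq_zero fun u _ => absurd u.2 (not_edge_source j)
  | hstep v hv ih =>
    rw [gain_of_not_isSource g i hv]
    refine Finset.sum_eq_zero fun u _ => ?_
    split_ifs with hu
    · rw [ih u hu fun h' => h (h'.tail hu), mul_zero]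
    · rfl

theorem gain_source_of_ne (g : V → R) {i j : Fin 2} (h : i ≠ j) : N.gain g i (N.s j) = 0 :=
  gain_eq_zero_of_not_reaches g fun h' => h (N.s_injective h'.source_eq)

/-- A gain describes what a node receives, before its own scaling, so only coefficients of strictly
earlier layers enter. -/
theorem gain_congr {g g' : V → R} (i : Fin 2) {v : V}
    (h : ∀ u, N.layer u < N.layer v → g u = g' u) : N.gain g i v = N.gain g' i v := by
  induction v using N.layer_induction with
  | hs j =>
    by_cases hij : i = j
    · rw [hij, gain_source_self, gain_source_self]
    · rw [gain_source_of_ne g hij, gain_source_of_ne g' hij]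
  | hstep v hv ih =>
    rw [gain_of_not_isSource g i hv, gain_of_not_isSource g' i hv]
    refine Finset.sum_congr rfl fun u _ => ?_
    split_ifs with hu
    · have := N.layer_of_edge u v hu
      rw [h u (by omega), ih u hu fun w hw => h w (by omega)]
    · rfl

/-- Gains are polynomial expressions in the coefficients. This makes every substitution possible:
evaluation at field elements, specialisation of indeterminates, restriction to one channel use. -/
theorem map_gain {S : Type*} [CommSemiring S] (φ : R →+* S) (g : V → R) (i : Fin 2) (v : V) :
    φ (N.gain g i v) = N.gain (fun u => φ (g u)) i v := by
  induction v using N.layer_induction with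
  | hs j =>
    by_cases hij : i = j
    · rw [hij, gain_source_self, gain_source_self, map_one]
    · rw [gain_source_of_ne _ hij, gain_source_of_ne _ hij, map_zero]
  | hstep v hv ih =>
    rw [gain_of_not_isSource g i hv, gain_of_not_isSource _ i hv, map_sum]
    refine Finset.sum_congr rfl fun u _ => ?_
    split_ifs with hu
    · rw [map_mul, ih u hu]
    · exact map_zero φ

open Classical in
theorem gain_eq_of_parents_eq (g : V → R) (i : Fin 2) {u v : V} (hu : ¬ N.IsSource u)
    (hv : ¬ N.IsSource v) (h : ∀ w, N.edge w u ↔ N.edge w v) : N.gain g i u = N.gain g i v := by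
  rw [gain_of_not_isSource g i hu, gain_of_not_isSource g i hv]
  exact Finset.sum_congr rfl fun w _ => if_congr (h w) rfl rfl

/-- A linear scheme delivers the combination of the source symbols with the gains. -/
theorem transmission_linear (α : V → R) (x : Fin 2 → R) (v : V) :
    N.transmission (fun j => α (N.s j) * x j) (fun v y => α v * y) v =
      α v * (x 0 * N.gain α 0 v + x 1 * N.gain α 1 v) := by
  induction v using N.layer_induction with
  | hs j =>
    rw [transmission_source]
    fin_cases j
    · simp [gain_source_self, gain_source_of_ne α (N := N) (one_ne_zero (α := Fin 2))]
    · simp [gain_source_self, gain_source_of_ne α (N := N) (zero_ne_one (α := Fin 2))]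
  | hstep v hv ih =>
    rw [transmission_of_not_isSource _ _ hv, gain_of_not_isSource α 0 hv,
      gain_of_not_isSource α 1 hv, reception_eq_sum_ite, Finset.mul_sum (a := x 0),
      Finset.mul_sum (a := x 1), ← Finset.sum_add_distrib]
    congr 1
    refine Finset.sum_congr rfl fun u _ => ?_
    split_ifs with hu
    · rw [ih u hu]; ring
    · simp

theorem reception_linear (α : V → R) (x : Fin 2 → R) {v : V} (hv : ¬ N.IsSource v) :
    N.reception (fun j => α (N.s j) * x j) (fun v y => α v * y) v =
      x 0 * N.gain α 0 v + x 1 * N.gain α 1 v := by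
  rw [gain_of_not_isSource α 0 hv, gain_of_not_isSource α 1 hv, reception_eq_sum_ite,
    Finset.mul_sum, Finset.mul_sum, ← Finset.sum_add_distrib]
  refine Finset.sum_congr rfl fun u _ => ?_
  split_ifs with hu
  · rw [transmission_linear]; ring
  · simp

/-- Nodes along a path can forward what its first node receives. -/
theorem exists_relay_path {w t : V} (h : N.Reaches w t) :
    ∃ P : Set V, ∀ (R : Type*) [CommSemiring R] (g : V → R),
      (∀ z, N.layer w ≤ N.layer z → N.layer z < N.layer t → g z = P.indicator 1 z) →
      ∀ i, N.gain g i t = N.gain g i w := by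
  classical
  induction h with
  | refl => exact ⟨∅, fun _ _ _ _ _ => rfl⟩
  | @tail u t hwu hut ih =>
    obtain ⟨P, hP⟩ := ih
    have hl := N.layer_of_edge u t hut
    have hl' := Reaches.layer_le (N := N) hwu
    -- In the layer of `u` only `u` sends, so `t` hears `u` alone; the other layers keep the earlier
    -- choice.
    refine ⟨{z | if N.layer z = N.layer u then z = u else z ∈ P}, fun R _ g hg i => ?_⟩
    rw [← hP R g (fun z hz hz' => ?_) i, gain_of_not_isSource g i (not_isSource_of_edge hut),
      Finset.sum_eq_single u, if_pos hut, hg u hl' (by omega)]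
    · simp
    · intro z _ hz
      split_ifs with hzt
      · have := N.layer_of_edge z t hzt
        rw [hg z (by omega) (by omega), Set.indicator_of_notMem, zero_mul]
        simp [show N.layer z = N.layer u by omega, hz]
      · rfl
    · simp
    · rw [hg z hz (by omega)]
      simp [Set.indicator, hz'.ne]

end Gain

end LayeredNetwork

namespace LayeredNetwork

variable {V : Type*} {N : LayeredNetwork V} [Fintype V]

/-! ### Outer bounds -/

section Converse

theorem transmission_eq_of_not_reaches {M : Type*} [AddCommMonoid M] {x x' : Fin 2 → M}
    {f : V → M → M} {i : Fin 2} (hx : ∀ j ≠ i, x j = x' j) {v : V}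
    (hv : ¬ N.Reaches (N.s i) v) : N.transmission x f v = N.transmission x' f v := by
  induction v using N.layer_induction with
  | hs j =>
    rw [transmission_source, transmission_source]
    refine hx j ?_
    rintro rfl
    exact hv .refl
  | hstep v hs ih =>
    rw [transmission_of_not_isSource _ _ hs, transmission_of_not_isSource _ _ hs,
      reception_eq_sum_ite, reception_eq_sum_ite]
    congr 1
    refine Finset.sum_congr rfl fun u _ => ?_
    split_ifs with hu
    · exact ih u hu fun h => hv (h.tail hu)
    · rfl

/-- If the receptions at the nodes of a vertex cut and the symbols of the sources that it does not
separate are given, then so is the reception behind the cut. -/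
theorem IsVertexCut.reception_eq {M : Type*} [AddCommMonoid M] {x x' : Fin 2 → M}
    {f : V → M → M} {T A : Set V} {b : V} (hcut : N.IsVertexCut T A {b})
    (hT : ∀ u ∈ T, ¬ N.IsSource u ∧ N.reception x f u = N.reception x' f u)
    (hx : ∀ i, N.s i ∉ A → x i = x' i) (hb : ¬ N.IsSource b) :
    N.reception x f b = N.reception x' f b := by
  refine (hcut.induction (P := fun u => (¬ N.IsSource u → N.reception x f u = N.reception x' f u) ∧
    N.transmission x f u = N.transmission x' f u) ?_ ?_ ?_).1 hb
  · intro u hu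
    obtain ⟨h1, h2⟩ := hT u hu
    refine ⟨fun _ => h2, ?_⟩
    rw [transmission_of_not_isSource _ _ h1, transmission_of_not_isSource _ _ h1, h2]
  · intro i hi
    refine ⟨fun h => absurd ⟨i, rfl⟩ h, ?_⟩
    rw [transmission_source, transmission_source, hx i hi]
  · intro v hv ih
    have h : N.reception x f v = N.reception x' f v := by
      rw [reception_eq_sum_ite, reception_eq_sum_ite]
      refine Finset.sum_congr rfl fun u _ => ?_
      split_ifs with hu
      · exact (ih u hu).2
      · rfl
    refine ⟨fun _ => h, ?_⟩
    rw [transmission_of_not_isSource _ _ hv, transmission_of_not_isSource _ _ hv, h]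

open Classical in
theorem reception_eq_of_parents_eq {M : Type*} [AddCommMonoid M] (x : Fin 2 → M)
    (f : V → M → M) {u v : V} (h : ∀ w, N.edge w u ↔ N.edge w v) :
    N.reception x f u = N.reception x f v := by
  rw [reception_eq_sum_ite, reception_eq_sum_ite]
  exact Finset.sum_congr rfl fun w _ => if_congr (h w) rfl rfl

open Classical in
-- The second sum does not depend on the symbol of `s i`, so once the other symbol is fixed only the
-- first sum matters.
theorem reception_eq_add {M : Type*} [AddCommMonoid M] (x : Fin 2 → M) (f : V → M → M)
    (i : Fin 2) (v : V) :
    N.reception x f v = (∑ u, if u ∈ N.parentsFrom i v then N.transmission x f u else 0) +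
      ∑ u, if N.edge u v ∧ ¬ N.Reaches (N.s i) u then N.transmission x f u else 0 := by
  rw [reception_eq_sum_ite, ← Finset.sum_add_distrib]
  refine Finset.sum_congr rfl fun u _ => ?_
  by_cases h1 : N.edge u v <;> by_cases h2 : N.Reaches (N.s i) u <;> simp [parentsFrom, h1, h2]

/-- Given the symbols of the other source, the receptions of the `s i`-clones of a node are
determined by the reception of the node. -/
theorem reception_eq_of_mem_clonesFrom {M : Type*} [AddCancelCommMonoid M] {x x' : Fin 2 → M}
    {f : V → M → M} {i : Fin 2} (hx : ∀ j ≠ i, x j = x' j) {u v : V}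
    (hu : u ∈ N.clonesFrom i v) (h : N.reception x f v = N.reception x' f v) :
    N.reception x f u = N.reception x' f u := by
  classical
  have key : ∀ w, (∑ u, if N.edge u w ∧ ¬ N.Reaches (N.s i) u then N.transmission x f u else 0) =
      ∑ u, if N.edge u w ∧ ¬ N.Reaches (N.s i) u then N.transmission x' f u else 0 := by
    intro w
    refine Finset.sum_congr rfl fun u _ => ?_
    split_ifs with hu
    · exact transmission_eq_of_not_reaches hx hu.2
    · rfl
  rw [reception_eq_add x f i, reception_eq_add x' f i, key] at h
  rw [reception_eq_add x f i, reception_eq_add x' f i, key, parentsFrom_eq_of_mem_clonesFrom hu,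
    add_right_cancel h]

/-- The reception of an omniscient node determines the reception of one destination and, with the
message of its user, that of the other destination. -/
theorem reception_eq_of_cuts {M : Type*} [AddCancelCommMonoid M] {i j : Fin 2} (hij : i ≠ j)
    (hreach : ∀ i, N.Reaches (N.s i) (N.d i)) {v : V}
    (h1 : N.IsVertexCut (N.clones v) {N.s 0, N.s 1} {N.d i})
    (h2 : N.IsVertexCut (N.clonesFrom j v) {N.s j} {N.d j}) {x x' : Fin 2 → M} {f : V → M → M}
    (h : N.reception x f v = N.reception x' f v) :
    N.reception x f (N.d i) = N.reception x' f (N.d i) ∧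
      (x i = x' i → N.reception x f (N.d j) = N.reception x' f (N.d j)) := by
  -- A source is its only clone, so as a source `v` would have to lie on paths from both `s i` and
  -- `s j` and equal each of them.
  have hv : ¬ N.IsSource v := by
    rintro ⟨m, rfl⟩
    rw [clones_source] at h1
    rw [clonesFrom_source] at h2
    obtain ⟨u, rfl, hu, -⟩ := h1.exists_mem (source_mem_pair i) (hreach i)
    obtain ⟨w, rfl, hw, -⟩ := h2.exists_mem (Set.mem_singleton _) (hreach j)
    exact hij (N.s_injective (hu.source_eq.trans hw.source_eq.symm))
  constructor
  · refine h1.reception_eq (fun u hu => ⟨not_isSource_of_mem_clones hu hv, ?_⟩)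
      (fun k hk => absurd (source_mem_pair k) hk) (not_isSource_dest i)
    rw [reception_eq_of_parents_eq x f fun w => edge_iff_of_mem_clones hu,
      reception_eq_of_parents_eq x' f fun w => edge_iff_of_mem_clones hu, h]
  · intro hx
    have hx' : ∀ k ≠ j, x k = x' k := by
      intro k hk
      have : k = i := by omega
      rw [this, hx]
    exact h2.reception_eq (fun u hu => ⟨not_isSource_of_mem_clonesFrom hu hv,
      reception_eq_of_mem_clonesFrom hx' hu h⟩) (fun k hk => hx' k fun h => hk (h ▸ rfl))
      (not_isSource_dest j)

/-- If correctly decoded message pairs are determined by an observation and the error probability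
is at most one half, then there are at most twice as many pairs as observations. -/
theorem card_messages_le {n : ℕ} {m : Fin 2 → ℕ} (c : BlockCode V n m)
    (hc : N.errorProbability c ≤ 1 / 2) {β : Type*} [Finite β]
    (φ : ((i : Fin 2) → Fin (m i)) → β)
    (hφ : ∀ w w', (∀ i, N.decoded c w i = w i) → (∀ i, N.decoded c w' i = w' i) → φ w = φ w' →
      w = w') : m 0 * m 1 ≤ 2 * Nat.card β := by
  classical
  have hcard : Nat.card ((i : Fin 2) → Fin (m i)) = m 0 * m 1 := by
    simp [Nat.card_eq_fintype_card, Fintype.card_pi]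
  have hgood : Nat.card {w : (i : Fin 2) → Fin (m i) // ∀ i, N.decoded c w i = w i} ≤
      Nat.card β :=
    Nat.card_le_card_of_injective (fun w => φ w.1)
      fun w w' h => Subtype.ext (hφ _ _ w.2 w'.2 h)
  have hsum : Nat.card {w : (i : Fin 2) → Fin (m i) // ∃ i, N.decoded c w i ≠ w i} +
      Nat.card {w : (i : Fin 2) → Fin (m i) // ∀ i, N.decoded c w i = w i} = m 0 * m 1 := by
    rw [← hcard]
    simp only [Nat.card_eq_fintype_card]
    have := Fintype.card_subtype_compl fun w : (i : Fin 2) → Fin (m i) =>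
      ∀ i, N.decoded c w i = w i
    have h2 := Fintype.card_subtype_le fun w : (i : Fin 2) → Fin (m i) =>
      ∀ i, N.decoded c w i = w i
    simp only [not_forall] at this
    simp only [ne_eq]
    omega
  rw [errorProbability, hcard] at hc
  -- Without message pairs the error probability is `0 / 0 = 0`, and the bound is trivial.
  rcases Nat.eq_zero_or_pos (m 0 * m 1) with h0 | h0
  · omega
  rw [div_le_iff₀ (by exact_mod_cast h0)] at hc
  have hc' : 2 * Nat.card {w : (i : Fin 2) → Fin (m i) // ∃ i, N.decoded c w i ≠ w i} ≤
      m 0 * m 1 := by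
    have : (2 * Nat.card {w : (i : Fin 2) → Fin (m i) // ∃ i, N.decoded c w i ≠ w i} : ℝ) ≤
        (m 0 * m 1 : ℕ) := by linarith
    exact_mod_cast this
  omega

/-- The factor two is the price of an error probability up to one half. It costs one bit per block,
which no positive excess rate survives as `n` grows. -/
theorem rate_le_one {ρ : ℝ} {n₀ : ℕ}
    (h : ∀ n : ℕ, n₀ ≤ n → (2 : ℝ) ^ ((n : ℝ) * ρ) ≤ 2 * 2 ^ n) : ρ ≤ 1 := by
  by_contra! hρ
  obtain ⟨n, hn⟩ := exists_nat_gt (max (n₀ : ℝ) (1 / (ρ - 1)))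
  have h1 := h n (by exact_mod_cast ((le_max_left _ _).trans_lt hn).le)
  have h2 : 1 < n * (ρ - 1) := by
    rw [← div_lt_iff₀ (by linarith)]
    exact (le_max_right _ _).trans_lt hn
  rw [← Real.rpow_natCast, ← Real.rpow_one_add' (by positivity) (by positivity),
    Real.rpow_le_rpow_left_iff (by norm_num)] at h1
  linarith

/-- For each user, the observation consists of the other user's message and the block at the user's
own destination. The number of messages of the other user then cancels. -/
theorem Achievable.mem_square {R : ℝ × ℝ} (h : N.Achievable R) : R ∈ squareRegion := by
  obtain ⟨h1, h2, h⟩ := h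
  obtain ⟨n₀, hn⟩ := h (1 / 2) (by norm_num)
  refine ⟨h1, h2, rate_le_one (n₀ := n₀) fun n hn' => ?_, rate_le_one (n₀ := n₀) fun n hn' => ?_⟩
  · obtain ⟨m, c, hm0, hm1, hc⟩ := hn n hn'
    have hpos : 0 < m 1 := by
      exact_mod_cast lt_of_lt_of_le (Real.rpow_pos_of_pos two_pos _) hm1
    have := card_messages_le c hc (β := Fin (m 1) × (Fin n → ZMod 2))
      (fun w => (w 1, N.reception (fun j => c.encoder j (w j)) c.relay (N.d 0))) (by
        intro w w' hw hw' h
        simp only [Prod.mk.injEq] at h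
        funext i
        fin_cases i
        · change w 0 = w' 0
          rw [← hw 0, ← hw' 0, decoded, decoded, h.2]
        · exact h.1)
    simp only [Nat.card_prod, Nat.card_fun, Nat.card_fin, Nat.card_zmod] at this
    have h3 : m 0 ≤ 2 * 2 ^ n := by
      refine Nat.le_of_mul_le_mul_right (this.trans_eq ?_) hpos
      ring
    exact hm0.trans (by exact_mod_cast h3)
  · obtain ⟨m, c, hm0, hm1, hc⟩ := hn n hn'
    have hpos : 0 < m 0 := by
      exact_mod_cast lt_of_lt_of_le (Real.rpow_pos_of_pos two_pos _) hm0
    have := card_messages_le c hc (β := Fin (m 0) × (Fin n → ZMod 2))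
      (fun w => (w 0, N.reception (fun j => c.encoder j (w j)) c.relay (N.d 1))) (by
        intro w w' hw hw' h
        simp only [Prod.mk.injEq] at h
        funext i
        fin_cases i
        · exact h.1
        · change w 1 = w' 1
          rw [← hw 1, ← hw' 1, decoded, decoded, h.2])
    simp only [Nat.card_prod, Nat.card_fun, Nat.card_fin, Nat.card_zmod] at this
    have h3 : m 1 ≤ 2 * 2 ^ n := by
      refine Nat.le_of_mul_le_mul_left (this.trans_eq ?_) hpos
      ring
    exact hm1.trans (by exact_mod_cast h3)

theorem Achievable.mem_triangle {R : ℝ × ℝ} (h : N.Achievable R)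
    (hreach : ∀ i, N.Reaches (N.s i) (N.d i)) {v : V} (hv : N.IsOmniscient v) :
    R ∈ triangleRegion := by
  obtain ⟨h1, h2, h⟩ := h
  obtain ⟨n₀, hn⟩ := h (1 / 2) (by norm_num)
  refine ⟨h1, h2, rate_le_one (n₀ := n₀) fun n hn' => ?_⟩
  obtain ⟨m, c, hm0, hm1, hc⟩ := hn n hn'
  have key : ∃ i j : Fin 2, i ≠ j ∧ N.IsVertexCut (N.clones v) {N.s 0, N.s 1} {N.d i} ∧
      N.IsVertexCut (N.clonesFrom j v) {N.s j} {N.d j} := by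
    rcases hv with hv | hv
    · exact ⟨0, 1, by decide, hv⟩
    · exact ⟨1, 0, by decide, hv⟩
  obtain ⟨i, j, hij, hi, hj⟩ := key
  have := card_messages_le c hc (β := Fin n → ZMod 2)
    (fun w => N.reception (fun j => c.encoder j (w j)) c.relay v) (by
      intro w w' hw hw' h
      obtain ⟨e1, e2⟩ := reception_eq_of_cuts hij hreach hi hj h
      have hwi : w i = w' i := by rw [← hw i, ← hw' i, decoded, decoded, e1]
      have hwj : w j = w' j := by
        rw [← hw j, ← hw' j, decoded, decoded, e2 (by rw [hwi])]
      funext k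
      obtain rfl | rfl : k = i ∨ k = j := by omega
      · exact hwi
      · exact hwj)
  simp only [Nat.card_fun, Nat.card_fin, Nat.card_zmod] at this
  rw [mul_add, Real.rpow_add two_pos]
  calc _ ≤ (m 0 : ℝ) * m 1 := by gcongr
    _ ≤ _ := by exact_mod_cast this

end Converse

/-! ### Block codes, time sharing and the capacity regions -/

section TimeSharing

/-- A scheme over a group of size `2 ^ n` that never errs is a block code of length `n`. -/
theorem exists_blockCode {n : ℕ} {M : Type*} [AddCommMonoid M] (e : M ≃+ (Fin n → ZMod 2))
    {m : Fin 2 → ℕ} (enc : (i : Fin 2) → Fin (m i) → M) (f : V → M → M)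
    (D : (i : Fin 2) → M → Fin (m i))
    (h : ∀ (w : (i : Fin 2) → Fin (m i)) i,
      D i (N.reception (fun j => enc j (w j)) f (N.d i)) = w i) :
    ∃ c : BlockCode V n m, N.errorProbability c = 0 := by
  refine ⟨⟨fun i w => e (enc i w), fun v y => e (f v (e.symm y)), fun i y => D i (e.symm y)⟩, ?_⟩
  have key : ∀ (x : Fin 2 → M) v,
      N.transmission (fun j => e (x j)) (fun v y => e (f v (e.symm y))) v =
        e (N.transmission x f v) := by
    intro x v
    induction v using N.layer_induction with
    | hs j => rw [transmission_source, transmission_source]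
    | hstep v hv ih =>
      rw [transmission_of_not_isSource _ _ hv, transmission_of_not_isSource _ _ hv,
        reception_eq_sum_ite, reception_eq_sum_ite, map_sum]
      congr 2
      refine Finset.sum_congr rfl fun u _ => ?_
      split_ifs with hu
      · rw [ih u hu, e.symm_apply_apply]
      · exact map_zero _
  rw [errorProbability, div_eq_zero_iff]
  left
  rw [Nat.cast_eq_zero, Nat.card_eq_zero]
  left
  rw [isEmpty_subtype]
  rintro w ⟨i, hi⟩
  refine hi ?_
  rw [decoded]
  conv_rhs => rw [← h w i]
  refine congrArg (D i) ?_
  rw [AddEquiv.symm_apply_eq, reception_eq_sum_ite, reception_eq_sum_ite, map_sum]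
  refine Finset.sum_congr rfl fun u _ => ?_
  split_ifs with hu
  · exact key _ _
  · exact (map_zero e).symm

theorem natCast_le_pow_ceil {x : ℝ} : (2 : ℝ) ^ x ≤ (2 ^ ⌈x⌉₊ : ℕ) := by
  rw [Nat.cast_pow, Nat.cast_ofNat, ← Real.rpow_natCast]
  exact Real.rpow_le_rpow_of_exponent_le (by norm_num) (Nat.le_ceil x)

/-- If each source reaches its destination, the users can share the channel uses. -/
theorem exists_blockCode_timeSharing (hreach : ∀ i, N.Reaches (N.s i) (N.d i)) {n : ℕ}
    (a : Fin 2 → ℕ) (ha : a 0 + a 1 ≤ n) :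
    ∃ c : BlockCode V n (fun i => 2 ^ a i), N.errorProbability c = 0 := by
  -- `p` gives each message bit of either user its own channel use.
  obtain ⟨p⟩ : Nonempty ((Σ i, Fin (a i)) ↪ Fin n) :=
    Function.Embedding.nonempty_of_card_le (by simpa using ha)
  have e : ∀ i, Fin (2 ^ a i) ≃ (Fin (a i) → ZMod 2) := fun i =>
    Fintype.equivOfCardEq (by simp)
  choose P hP using fun i => exists_relay_path (hreach i)
  -- Unused channel uses go to user `0` by default, which is harmless. The code is a linear scheme
  -- over the product ring `Fin n → ZMod 2`, where each coordinate switches on the relay path of its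
  -- owner.
  let owner : Fin n → Fin 2 := Function.extend p Sigma.fst 0
  let α : V → Fin n → ZMod 2 := fun v k => (P (owner k)).indicator 1 v
  let x : (i : Fin 2) → Fin (2 ^ a i) → Fin n → ZMod 2 :=
    fun i w => Function.extend (fun k => p ⟨i, k⟩) (e i w) 0
  refine exists_blockCode (AddEquiv.refl _) (fun i w => α (N.s i) * x i w) (fun v y => α v * y)
    (fun i y => (e i).symm fun k => y (p ⟨i, k⟩)) fun w i => ?_
  rw [Equiv.symm_apply_eq]
  funext k
  have hgain : ∀ l, N.gain α l (N.d i) (p ⟨i, k⟩) = if l = i then 1 else 0 := by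
    intro l
    have h1 := map_gain (N := N) (Pi.evalRingHom (fun _ => ZMod 2) (p ⟨i, k⟩)) α l (N.d i)
    rw [Pi.evalRingHom_apply] at h1
    rw [h1, hP i _ _ (fun z _ _ => ?_) l]
    · split_ifs with h
      · rw [h, gain_source_self]
      · exact gain_source_of_ne _ h
    · simp only [Pi.evalRingHom_apply, α, owner, p.injective.extend_apply]
  have hinj : Function.Injective fun k => p ⟨i, k⟩ := fun k k' h => by
    simpa using p.injective h
  have hx : x i (w i) (p ⟨i, k⟩) = e i (w i) k := hinj.extend_apply _ _ _
  rw [reception_linear α (fun i => x i (w i)) (not_isSource_dest i), ← hx, Pi.add_apply,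
    Pi.mul_apply, Pi.mul_apply, hgain, hgain]
  obtain rfl | rfl : i = 0 ∨ i = 1 := by omega
  · simp
  · simp

theorem achievable_of_add_lt_one (hreach : ∀ i, N.Reaches (N.s i) (N.d i)) {R : ℝ × ℝ}
    (h0 : 0 ≤ R.1) (h1 : 0 ≤ R.2) (h : R.1 + R.2 < 1) : N.Achievable R := by
  refine ⟨h0, h1, fun ε hε => ?_⟩
  -- The slack must absorb two roundings up, each by less than one bit.
  obtain ⟨n₀, hn₀⟩ := exists_nat_gt (2 / (1 - (R.1 + R.2)))
  refine ⟨n₀, fun n hn => ?_⟩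
  have hn' : 2 < n * (1 - (R.1 + R.2)) := by
    rw [← div_lt_iff₀ (by linarith)]
    exact hn₀.trans_le (by exact_mod_cast hn)
  have hc0 := Nat.ceil_lt_add_one (mul_nonneg (Nat.cast_nonneg (α := ℝ) n) h0)
  have hc1 := Nat.ceil_lt_add_one (mul_nonneg (Nat.cast_nonneg (α := ℝ) n) h1)
  have hle : ⌈(n : ℝ) * R.1⌉₊ + ⌈(n : ℝ) * R.2⌉₊ ≤ n := by
    have : ((⌈(n : ℝ) * R.1⌉₊ + ⌈(n : ℝ) * R.2⌉₊ : ℕ) : ℝ) ≤ n := by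
      push_cast
      linarith
    exact_mod_cast this
  obtain ⟨c, hc⟩ := exists_blockCode_timeSharing hreach ![⌈(n : ℝ) * R.1⌉₊, ⌈(n : ℝ) * R.2⌉₊] hle
  exact ⟨_, c, natCast_le_pow_ceil, natCast_le_pow_ceil, hc.trans_le hε.le⟩

theorem isClosed_triangleRegion : IsClosed triangleRegion :=
  (isClosed_le continuous_const continuous_fst).inter
    ((isClosed_le continuous_const continuous_snd).inter
      (isClosed_le (continuous_fst.add continuous_snd) continuous_const))

theorem isClosed_squareRegion : IsClosed squareRegion :=
  (isClosed_le continuous_const continuous_fst).inter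
    ((isClosed_le continuous_const continuous_snd).inter
      ((isClosed_le continuous_fst continuous_const).inter
        (isClosed_le continuous_snd continuous_const)))

/-- Shrinking a point slightly towards the origin makes its rate sum strictly less than one, and the
closure restores the boundary. -/
theorem triangleRegion_subset_capacityRegion (hreach : ∀ i, N.Reaches (N.s i) (N.d i)) :
    triangleRegion ⊆ N.capacityRegion := by
  rintro R ⟨h0, h1, h⟩
  have hlim : Tendsto (fun n : ℕ => (1 - 1 / ((n : ℝ) + 1)) • R) atTop (𝓝 R) := by
    have := (tendsto_const_nhds (x := (1 : ℝ))).sub (tendsto_one_div_add_atTop_nhds_zero_nat (𝕜 := ℝ))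
    simpa using this.smul_const R
  refine mem_closure_of_tendsto hlim (Eventually.of_forall fun n => ?_)
  have hpos : 0 < 1 / ((n : ℝ) + 1) := by positivity
  have hle : 1 / ((n : ℝ) + 1) ≤ 1 := by
    rw [div_le_one (by positivity)]
    linarith [Nat.cast_nonneg (α := ℝ) n]
  refine achievable_of_add_lt_one hreach (mul_nonneg (by linarith) h0)
    (mul_nonneg (by linarith) h1) ?_
  simp only [Prod.smul_fst, Prod.smul_snd, smul_eq_mul]
  nlinarith [mul_le_mul_of_nonneg_left h (by linarith : 0 ≤ 1 - 1 / ((n : ℝ) + 1))]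

theorem capacityRegion_eq_triangleRegion (hreach : ∀ i, N.Reaches (N.s i) (N.d i)) {v : V}
    (hv : N.IsOmniscient v) : N.capacityRegion = triangleRegion :=
  (closure_minimal (fun _ hR => Achievable.mem_triangle hR hreach hv)
    isClosed_triangleRegion).antisymm (triangleRegion_subset_capacityRegion hreach)

theorem Achievable.mono {R R' : ℝ × ℝ} (h : N.Achievable R) (h0 : 0 ≤ R'.1) (h1 : 0 ≤ R'.2)
    (hle : R' ≤ R) : N.Achievable R' := by
  refine ⟨h0, h1, fun ε hε => ?_⟩
  obtain ⟨n₀, hn₀⟩ := h.2.2 ε hε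
  refine ⟨n₀, fun n hn => ?_⟩
  obtain ⟨m, c, hm0, hm1, hc⟩ := hn₀ n hn
  have hn' := Nat.cast_nonneg (α := ℝ) n
  exact ⟨m, c, (Real.rpow_le_rpow_of_exponent_le (by norm_num)
      (mul_le_mul_of_nonneg_left hle.1 hn')).trans hm0,
    (Real.rpow_le_rpow_of_exponent_le (by norm_num)
      (mul_le_mul_of_nonneg_left hle.2 hn')).trans hm1, hc⟩

theorem capacityRegion_eq_squareRegion (h : N.Achievable (1, 1)) :
    N.capacityRegion = squareRegion :=
  (closure_minimal (fun _ hR => Achievable.mem_square hR) isClosed_squareRegion).antisymm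
    fun _ hR => subset_closure (h.mono hR.1 hR.2.1 ⟨hR.2.2.1, hR.2.2.2⟩)

theorem not_isOmniscient_of_achievable (hreach : ∀ i, N.Reaches (N.s i) (N.d i))
    (h : N.Achievable (1, 1)) (v : V) : ¬ N.IsOmniscient v := by
  intro hv
  have := (h.mem_triangle hreach hv).2.2
  norm_num at this

end TimeSharing

end LayeredNetwork

namespace LayeredNetwork

variable {V : Type*} {N : LayeredNetwork V} [Fintype V]

/-! ### From polynomial identities to random coding and block codes -/

section RandomCoding

/-- A scalar linear scheme decodes if each destination receives its own symbol without
interference. -/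
theorem linearSchemeDecodes_of_gain {F : Type*} [Field F] {α : V → F}
    (h0 : N.gain α 0 (N.d 0) ≠ 0) (h1 : N.gain α 1 (N.d 0) = 0) (h2 : N.gain α 0 (N.d 1) = 0)
    (h3 : N.gain α 1 (N.d 1) ≠ 0) : N.LinearSchemeDecodes α := by
  refine ⟨fun i y => y / N.gain α i (N.d i), fun x i => ?_⟩
  change N.reception _ _ _ / _ = _
  rw [reception_linear α x (not_isSource_dest i)]
  obtain rfl | rfl : i = 0 ∨ i = 1 := by omega
  · rw [h1, mul_zero, add_zero, mul_div_cancel_right₀ _ h0]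
  · rw [h2, mul_zero, zero_add, mul_div_cancel_right₀ _ h3]

/-- The probability that a polynomial over `𝔽₂` that is not zero vanishes at a random point is at
most its degree over the size of the field. -/
theorem card_zeros_le {p : MvPolynomial V (ZMod 2)} (hp : p ≠ 0) (F : Type*) [Field F]
    [Algebra (ZMod 2) F] [Fintype F] :
    (Nat.card {α : V → F // MvPolynomial.aeval α p = 0} : ℝ) / Nat.card (V → F) ≤
      p.totalDegree / Nat.card F := by
  classical
  have e := Fintype.equivFin V
  -- Extension of scalars and renaming of variables are injective and do not raise the degree, so
  -- Schwartz–Zippel for `q` bounds the zeros of `p`.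
  set q : MvPolynomial (Fin (Fintype.card V)) F :=
    MvPolynomial.rename e (MvPolynomial.map (algebraMap (ZMod 2) F) p) with hq
  have hq0 : q ≠ 0 := by
    rw [hq, Ne, ← map_zero (MvPolynomial.rename e), (MvPolynomial.rename_injective e e.injective).eq_iff,
      ← map_zero (MvPolynomial.map (σ := V) (algebraMap (ZMod 2) F)),
      (MvPolynomial.map_injective _ (algebraMap (ZMod 2) F).injective).eq_iff]
    exact hp
  have hdeg : q.totalDegree ≤ p.totalDegree :=
    (MvPolynomial.totalDegree_rename_le _ _).trans (by
      exact Finset.sup_mono (MvPolynomial.support_map_subset _ _))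
  have hsz := MvPolynomial.schwartz_zippel_totalDegree hq0 (Finset.univ : Finset F)
  have hcard : Nat.card {α : V → F // MvPolynomial.aeval α p = 0} =
      (Finset.filter (fun f => MvPolynomial.eval f q = 0)
        (Fintype.piFinset fun _ => (Finset.univ : Finset F))).card := by
    rw [Fintype.piFinset_univ, ← Fintype.card_subtype, ← Nat.card_eq_fintype_card]
    refine Nat.card_congr ((Equiv.arrowCongr e (Equiv.refl F)).subtypeEquiv fun α => ?_)
    rw [hq, MvPolynomial.eval_rename, MvPolynomial.eval_map, MvPolynomial.aeval_def]
    have : (Equiv.arrowCongr e (Equiv.refl F)) α ∘ e = α := by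
      funext v; simp [Equiv.arrowCongr]
    rw [this]
  rw [hcard, Nat.card_fun, Nat.card_eq_fintype_card (α := F), Nat.card_eq_fintype_card (α := V)]
  rw [Finset.card_univ] at hsz
  have hsz' := (NNRat.cast_le (K := ℝ)).2 hsz
  push_cast at hsz' ⊢
  refine hsz'.trans ?_
  gcongr

/-- A scheme whose coefficients are polynomials in the random coefficients works with high
probability if it works for the generic values of the random coefficients. -/
theorem randomLinearCoding_of_polynomial {S : Set V} {p : V → MvPolynomial V (ZMod 2)}
    (hp : ∀ v, p v ∈ MvPolynomial.supported (ZMod 2) {u | u ∉ S ∧ N.layer u < N.layer v})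
    {g : V → MvPolynomial V (ZMod 2)} (hgS : ∀ v ∈ S, g v = p v)
    (hg : ∀ v ∉ S, g v = MvPolynomial.X v)
    (h0 : N.gain g 0 (N.d 0) ≠ 0) (h1 : N.gain g 1 (N.d 0) = 0) (h2 : N.gain g 0 (N.d 1) = 0)
    (h3 : N.gain g 1 (N.d 1) ≠ 0) : N.RandomLinearCodingAchievesOneOne S := by
  classical
  refine ⟨fun r α v => MvPolynomial.aeval α (p v), ?_, ?_⟩
  · intro r v α α' h
    have hv := hp v
    rw [MvPolynomial.supported] at hv
    refine AlgHom.adjoin_le_equalizer (MvPolynomial.aeval α) (MvPolynomial.aeval α') ?_ hv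
    rintro _ ⟨u, hu, rfl⟩
    rw [MvPolynomial.aeval_X, MvPolynomial.aeval_X, h u hu.1 hu.2]
  -- One polynomial controls both direct gains; the cross gains vanish identically and survive every
  -- evaluation.
  set q := N.gain g 0 (N.d 0) * N.gain g 1 (N.d 1) with hq
  have hq0 : q ≠ 0 := mul_ne_zero h0 h3
  have key : ∀ r (α : V → GaloisField 2 r), MvPolynomial.aeval α q ≠ 0 →
      N.LinearSchemeDecodes
        (fun v => if v ∈ S then MvPolynomial.aeval α (p v) else α v) := by
    intro r α hα
    have hfun : (fun v => if v ∈ S then MvPolynomial.aeval α (p v) else α v) =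
        fun v => (MvPolynomial.aeval α : _ →ₐ[ZMod 2] GaloisField 2 r).toRingHom (g v) := by
      funext v
      split_ifs with hv
      · rw [hgS v hv]; rfl
      · rw [hg v hv]; exact (MvPolynomial.aeval_X α v).symm
    rw [hq, map_mul] at hα
    rw [hfun]
    apply linearSchemeDecodes_of_gain <;> rw [← map_gain]
    · exact left_ne_zero_of_mul hα
    · rw [h1, map_zero]
    · rw [h2, map_zero]
    · exact right_ne_zero_of_mul hα
  have hbound : ∀ᶠ r : ℕ in atTop, 1 - (q.totalDegree : ℝ) / 2 ^ r ≤
      (Nat.card {α : V → GaloisField 2 r // N.LinearSchemeDecodes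
        (fun v => if v ∈ S then MvPolynomial.aeval α (p v) else α v)} : ℝ) /
        Nat.card (V → GaloisField 2 r) := by
    -- The field has `2 ^ r` elements only for `r ≠ 0`.
    filter_upwards [eventually_ne_atTop 0] with r hr
    let _ : Fintype (GaloisField 2 r) := Fintype.ofFinite _
    have hz := card_zeros_le hq0 (GaloisField 2 r)
    rw [GaloisField.card 2 r hr, Nat.cast_pow, Nat.cast_ofNat] at hz
    have hpos : (0 : ℝ) < Nat.card (V → GaloisField 2 r) := by
      exact_mod_cast Nat.card_pos
    have hle : Nat.card (V → GaloisField 2 r) ≤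
        Nat.card {α : V → GaloisField 2 r // MvPolynomial.aeval α q = 0} +
        Nat.card {α : V → GaloisField 2 r // N.LinearSchemeDecodes
          (fun v => if v ∈ S then MvPolynomial.aeval α (p v) else α v)} := by
      have h4 : Nat.card {α : V → GaloisField 2 r // ¬ MvPolynomial.aeval α q = 0} ≤
          Nat.card {α : V → GaloisField 2 r // N.LinearSchemeDecodes
            (fun v => if v ∈ S then MvPolynomial.aeval α (p v) else α v)} :=
        Nat.card_le_card_of_injective (Subtype.map id (key r))
          (Subtype.map_injective _ Function.injective_id)
      have h5 := Fintype.card_subtype_compl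
        fun α : V → GaloisField 2 r => MvPolynomial.aeval α q = 0
      have h6 := Fintype.card_subtype_le
        fun α : V → GaloisField 2 r => MvPolynomial.aeval α q = 0
      simp only [← Nat.card_eq_fintype_card] at h5 h6
      omega
    rw [sub_le_iff_le_add]
    calc (1 : ℝ) = Nat.card (V → GaloisField 2 r) / Nat.card (V → GaloisField 2 r) :=
          (div_self hpos.ne').symm
      _ ≤ _ := div_le_div_of_nonneg_right (Nat.cast_le.2 hle) hpos.le
      _ ≤ _ := by
        rw [Nat.cast_add, add_div, add_comm]
        gcongr
  refine tendsto_of_tendsto_of_tendsto_of_le_of_le' ?_ tendsto_const_nhds hbound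
    (Eventually.of_forall fun r => ?_)
  · have := (tendsto_pow_atTop_nhds_zero_of_lt_one (r := (1 / 2 : ℝ)) (by norm_num)
      (by norm_num)).const_mul (q.totalDegree : ℝ)
    simpa [div_eq_mul_inv] using this.const_sub 1
  · refine div_le_one_of_le₀ ?_ (Nat.cast_nonneg _)
    exact_mod_cast Nat.card_le_card_of_injective _ Subtype.val_injective

/-- Positive probability already yields one coefficient vector that works. In a basis over `𝔽₂`,
addition in the field of size `2 ^ n` is bitwise XOR, so one symbol per user is `n` bits in `n`
channel uses, without error. -/
theorem achievable_of_randomLinearCoding {S : Set V}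
    (h : N.RandomLinearCodingAchievesOneOne S) : N.Achievable (1, 1) := by
  classical
  obtain ⟨σ, -, hσ⟩ := h
  refine ⟨zero_le_one, zero_le_one, fun ε hε => ?_⟩
  obtain ⟨n₀, hn₀⟩ := eventually_atTop.1 ((hσ.eventually_const_lt one_pos).and
    (eventually_ne_atTop 0))
  refine ⟨n₀, fun n hn => ⟨fun _ => 2 ^ n, ?_⟩⟩
  obtain ⟨hpos, hn0⟩ := hn₀ n hn
  let _ : Fintype (GaloisField 2 n) := Fintype.ofFinite _
  have hne : Nat.card {α : V → GaloisField 2 n //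
      N.LinearSchemeDecodes (fun v => if v ∈ S then σ n α v else α v)} ≠ 0 := by
    intro h
    rw [h, Nat.cast_zero, zero_div] at hpos
    exact hpos.false
  obtain ⟨⟨α', hα'⟩⟩ := (Nat.card_ne_zero.1 hne).1
  set α : V → GaloisField 2 n := fun v => if v ∈ S then σ n α' v else α' v
  obtain ⟨D, hD⟩ := hα'
  have e : GaloisField 2 n ≃+ (Fin n → ZMod 2) :=
    (Module.finBasisOfFinrankEq (ZMod 2) (GaloisField 2 n)
      (GaloisField.finrank 2 hn0)).equivFun.toAddEquiv
  have e' : Fin (2 ^ n) ≃ GaloisField 2 n := Fintype.equivOfCardEq (by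
    rw [← Nat.card_eq_fintype_card, ← Nat.card_eq_fintype_card, GaloisField.card 2 n hn0,
      Nat.card_eq_fintype_card, Fintype.card_fin])
  obtain ⟨c, hc⟩ := exists_blockCode (N := N) e (m := fun _ => 2 ^ n)
    (fun i w => α (N.s i) * e' w) (fun v y => α v * y) (fun i y => e'.symm (D i y))
    (fun w i => by
      rw [Equiv.symm_apply_eq]
      exact hD (fun i => e' (w i)) i)
  refine ⟨c, ?_, ?_, hc.trans_le hε.le⟩ <;> simp

end RandomCoding

end LayeredNetwork

namespace LayeredNetwork

variable {V : Type*} {N : LayeredNetwork V}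

/-! ### Generic coefficients and independent signals -/

section GenericCoding

open MvPolynomial (X aeval supported)

theorem algHom_eq_of_mem_supported {A : Type*} [CommSemiring A] [Algebra (ZMod 2) A]
    {φ ψ : MvPolynomial V (ZMod 2) →ₐ[ZMod 2] A} {s : Set V} (h : ∀ z ∈ s, φ (X z) = ψ (X z))
    {p : MvPolynomial V (ZMod 2)} (hp : p ∈ supported (ZMod 2) s) : φ p = ψ p := by
  rw [supported] at hp
  refine AlgHom.adjoin_le_equalizer φ ψ ?_ hp
  rintro _ ⟨u, hu, rfl⟩
  exact h u hu

variable [Fintype V]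

theorem gain_mem_supported {g : V → MvPolynomial V (ZMod 2)} {s : Set V} (i : Fin 2) {v : V}
    (hg : ∀ z, N.layer z < N.layer v → g z ∈ supported (ZMod 2) s) :
    N.gain g i v ∈ supported (ZMod 2) s := by
  induction v using N.layer_induction with
  | hs j =>
    by_cases hij : i = j
    · rw [hij, gain_source_self]
      exact one_mem _
    · rw [gain_source_of_ne g hij]
      exact zero_mem _
  | hstep v hv ih =>
    rw [gain_of_not_isSource g i hv]
    refine sum_mem fun u _ => ?_
    split_ifs with hu
    · have := N.layer_of_edge u v hu
      exact mul_mem (hg u (by omega)) (ih u hu fun z hz => hg z (by omega))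
    · exact zero_mem _

/-- Random coefficients behind a node preserve a gain of the node. -/
theorem gain_ne_zero_of_reaches {g : V → MvPolynomial V (ZMod 2)} {w t : V}
    (h : N.Reaches w t)
    (hlow : ∀ z, N.layer z < N.layer w →
      g z ∈ supported (ZMod 2) {u | N.layer u < N.layer w})
    (hhigh : ∀ z, N.layer w ≤ N.layer z → g z = X z) {i : Fin 2} (hw : N.gain g i w ≠ 0) :
    N.gain g i t ≠ 0 := by
  classical
  obtain ⟨P, hP⟩ := exists_relay_path h
  -- From the layer of `w` on, the indeterminates are specialised to a relay path; the gain at `t`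
  -- then becomes the nonzero gain at `w`.
  let φ : MvPolynomial V (ZMod 2) →ₐ[ZMod 2] MvPolynomial V (ZMod 2) :=
    aeval fun z => if N.layer z < N.layer w then X z else P.indicator 1 z
  have key : φ (N.gain g i t) = N.gain g i w := by
    refine (map_gain φ.toRingHom g i t).trans ((hP _ _ (fun z hz _ => ?_) i).trans
      (gain_congr i fun z hz => ?_))
    · rw [hhigh z hz]
      exact (MvPolynomial.aeval_X _ z).trans (if_neg (not_lt.2 hz))
    · refine algHom_eq_of_mem_supported (ψ := AlgHom.id _ _) (fun u hu => ?_) (hlow z hz)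
      exact (MvPolynomial.aeval_X _ u).trans (if_pos hu)
  intro h0
  rw [h0, map_zero] at key
  exact hw key.symm

/-- The gain of a node when the coefficients are indeterminates. -/
noncomputable abbrev genericGain (N : LayeredNetwork V) (i : Fin 2) (v : V) :
    MvPolynomial V (ZMod 2) := N.gain X i v

theorem genericGain_ne_zero {i : Fin 2} {v : V} (h : N.Reaches (N.s i) v) :
    N.genericGain i v ≠ 0 := by
  refine gain_ne_zero_of_reaches h (fun z hz => ?_) (fun _ _ => rfl) ?_
  · rw [layer_source] at hz
    omega
  · rw [gain_source_self]
    exact one_ne_zero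

theorem randomLinearCoding_of_not_reaches (hreach : ∀ i, N.Reaches (N.s i) (N.d i))
    (h0 : ¬ N.Reaches (N.s 1) (N.d 0)) (h1 : ¬ N.Reaches (N.s 0) (N.d 1)) :
    N.RandomLinearCodingAchievesOneOne ∅ :=
  randomLinearCoding_of_polynomial (p := 0) (g := X) (fun _ => zero_mem _)
    (fun _ h => absurd h (Set.notMem_empty _)) (fun _ _ => rfl) (genericGain_ne_zero (hreach 0))
    (gain_eq_zero_of_not_reaches _ h0) (gain_eq_zero_of_not_reaches _ h1)
    (genericGain_ne_zero (hreach 1))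

/-- The determinant of the gains of two nodes for indeterminate coefficients. -/
noncomputable def genericDet (N : LayeredNetwork V) (u w : V) : MvPolynomial V (ZMod 2) :=
  N.genericGain 0 u * N.genericGain 1 w - N.genericGain 1 u * N.genericGain 0 w

theorem genericDet_swap (u w : V) : N.genericDet u w = -N.genericDet w u := by
  rw [genericDet, genericDet]; ring

/-- A nonzero vector in the plane cannot be proportional to both of two independent vectors, and the
gain vector of `u` is nonzero because some source reaches `u`. -/
theorem genericDet_ne_zero_or {a b : V} (h : N.genericDet a b ≠ 0) (u : V) :
    N.genericDet u a ≠ 0 ∨ N.genericDet u b ≠ 0 := by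
  by_contra! hu
  obtain ⟨ha, hb⟩ := hu
  obtain ⟨i, hi⟩ := N.reached u
  have hi0 := genericGain_ne_zero hi
  refine h ((mul_eq_zero_iff_left hi0).1 ?_)
  rw [genericDet] at ha hb ⊢
  obtain rfl | rfl : i = 0 ∨ i = 1 := by omega
  · linear_combination N.genericGain 0 a * hb - N.genericGain 0 b * ha
  · linear_combination N.genericGain 1 a * hb - N.genericGain 1 b * ha

open Classical in
/-- The gain of a node if at most three of its parents send. -/
theorem gain_eq_of_three {R : Type*} [CommSemiring R] {g : V → R} {w u₁ u₂ u₃ : V} {c₁ c₂ c₃ : R}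
    (hw : ¬ N.IsSource w)
    (hg : ∀ z, N.edge z w → g z = (if z = u₁ then c₁ else 0) + (if z = u₂ then c₂ else 0) +
      (if z = u₃ then c₃ else 0)) (i : Fin 2) :
    N.gain g i w = (if N.edge u₁ w then c₁ * N.gain g i u₁ else 0) +
      (if N.edge u₂ w then c₂ * N.gain g i u₂ else 0) +
      (if N.edge u₃ w then c₃ * N.gain g i u₃ else 0) := by
  rw [gain_of_not_isSource g i hw]
  have : ∀ z, (if N.edge z w then g z * N.gain g i z else 0) =
      (if z = u₁ then (if N.edge u₁ w then c₁ * N.gain g i u₁ else 0) else 0) +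
      (if z = u₂ then (if N.edge u₂ w then c₂ * N.gain g i u₂ else 0) else 0) +
      (if z = u₃ then (if N.edge u₃ w then c₃ * N.gain g i u₃ else 0) else 0) := by
    intro z
    by_cases hz : N.edge z w
    · rw [if_pos hz, hg z hz, add_mul, add_mul, ite_mul, ite_mul, ite_mul, zero_mul]
      congr 1
      · congr 1
        · split_ifs <;> simp_all
        · split_ifs <;> simp_all
      · split_ifs <;> simp_all
    · rw [if_neg hz]
      split_ifs <;> simp_all
  simp only [this, Finset.sum_add_distrib, Finset.sum_ite_eq', Finset.mem_univ, if_true]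

/-- Two nodes that receive different combinations of independent signals receive independent
signals. -/
theorem genericDet_ne_zero_of_edge {u u' w w' : V} (h : N.genericDet u u' ≠ 0)
    (hl : N.layer u' = N.layer u) (h1 : N.edge u w) (h2 : ¬ N.edge u' w) (h3 : N.edge u' w') :
    N.genericDet w w' ≠ 0 := by
  classical
  -- From the layer of `u` on, only `u` and `u'` send. Then `w` receives the signal of `u`, and `w'`
  -- that of `u'` plus possibly that of `u`, which leaves the determinant unchanged. The third
  -- summand is zero and only gives the shape of `gain_eq_of_three`.
  let g : V → MvPolynomial V (ZMod 2) := fun z => if N.layer z < N.layer u then X z else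
    (if z = u then 1 else 0) + (if z = u' then 1 else 0) + (if z = u then 0 else 0)
  let φ : MvPolynomial V (ZMod 2) →ₐ[ZMod 2] MvPolynomial V (ZMod 2) := aeval g
  have hφ : ∀ i z, φ (N.genericGain i z) = N.gain g i z := by
    intro i z
    refine (map_gain φ.toRingHom X i z).trans (congrArg (fun g => N.gain g i z) ?_)
    funext z
    exact MvPolynomial.aeval_X _ z
  have hlow : ∀ i z, N.layer z = N.layer u → N.gain g i z = N.genericGain i z :=
    fun i z hz => gain_congr i fun y hy => if_pos (by omega)
  have hg : ∀ i {t}, N.layer t = N.layer u + 1 → N.gain g i t =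
      (if N.edge u t then 1 * N.gain g i u else 0) +
      (if N.edge u' t then 1 * N.gain g i u' else 0) +
      (if N.edge u t then 0 * N.gain g i u else 0) := by
    intro i t ht
    refine gain_eq_of_three (by rw [isSource_iff]; omega) (fun z hz => if_neg ?_) i
    have := N.layer_of_edge z t hz
    omega
  intro h0
  refine h ?_
  have h4 := congrArg φ h0
  have hw := N.layer_of_edge u w h1
  have hw' : N.layer w' = N.layer u + 1 := by rw [N.layer_of_edge u' w' h3, hl]
  rw [genericDet, map_sub, map_mul, map_mul, map_zero, hφ, hφ, hφ, hφ, hg 0 hw, hg 1 hw,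
    hg 0 hw', hg 1 hw', hlow _ u rfl, hlow _ u rfl, hlow _ u' hl, hlow _ u' hl] at h4
  simp only [if_pos h1, if_neg h2, if_pos h3] at h4
  rw [genericDet]
  split_ifs at h4 <;> linear_combination h4

/-- Since no node before a critical node is behind a bottleneck, each layer before it carries two
independent signals towards it. -/
theorem IsCritical.exists_genericDet_ne_zero {i : Fin 2} {v : V} (hv : N.IsCritical i v)
    (hs : ∀ i, N.Reaches (N.s i) v) {j : ℕ} (hj : j < N.layer v) :
    ∃ u u', N.layer u = j ∧ N.layer u' = j ∧ N.Reaches u v ∧ N.Reaches u' v ∧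
      N.genericDet u u' ≠ 0 := by
  induction j with
  | zero =>
    refine ⟨N.s 0, N.s 1, layer_source 0, layer_source 1, hs 0, hs 1, ?_⟩
    rw [genericDet, genericGain, genericGain, genericGain, gain_source_self, gain_source_self,
      gain_source_of_ne _ (one_ne_zero (α := Fin 2)), zero_mul, sub_zero, mul_one]
    exact one_ne_zero
  | succ j ih =>
    obtain ⟨a, b, hal, hbl, ha, hb, hab⟩ := ih (by omega)
    by_contra! hno
    -- If all determinants in layer `j + 1` towards `v` vanish, independent nodes of layer `j` must
    -- feed the same nodes on the way to `v`.
    have hstar : ∀ u u', N.layer u = j → N.layer u' = j → N.Reaches u' v →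
        N.genericDet u u' ≠ 0 → ∀ w, N.Reaches w v → N.edge u w → N.edge u' w := by
      intro u u' hu hu' hr hD w hw huw
      by_contra hu'w
      obtain ⟨w', hu'w', hw'⟩ := exists_child hr (by omega)
      have h1 := N.layer_of_edge u w huw
      have h2 := N.layer_of_edge u' w' hu'w'
      exact genericDet_ne_zero_of_edge hD (by omega) huw hu'w hu'w'
        (hno w w' (by omega) (by omega) hw hw')
    have hstar' : ∀ u u', N.layer u = j → N.layer u' = j → N.Reaches u v →
        N.genericDet u u' ≠ 0 → ∀ w, N.Reaches w v → N.edge u' w → N.edge u w := by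
      intro u u' hu hu' hr hD
      exact hstar u' u hu' hu hr (by rwa [genericDet_swap, neg_ne_zero])
    -- Any parent of `w` is independent of `a` or of `b`; so `a` and `b` are parents too, and
    -- through them every `u`.
    have hall : ∀ w, N.layer w = j + 1 → N.Reaches w v → ∀ u, N.layer u = j → N.Reaches u v →
        N.edge u w := by
      intro w hwl hw u hul hu
      obtain ⟨l, hl⟩ := N.reached w
      obtain ⟨z, hzw, -⟩ := exists_edge_of_not_isSource hl (by rw [isSource_iff]; omega)
      have hzl := N.layer_of_edge z w hzw
      have hab' : N.edge a w ∧ N.edge b w := by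
        rcases genericDet_ne_zero_or hab z with h | h
        · have h1 := hstar z a (by omega) hal ha h w hw hzw
          exact ⟨h1, hstar a b hal hbl hb hab w hw h1⟩
        · have h1 := hstar z b (by omega) hbl hb h w hw hzw
          exact ⟨hstar' a b hal hbl ha hab w hw h1, h1⟩
      rcases genericDet_ne_zero_or hab u with h | h
      · exact hstar' u a hul hal hu h w hw hab'.1
      · exact hstar' u b hul hbl hu h w hw hab'.2
    obtain ⟨w₀, haw₀, hw₀⟩ := exists_child ha (by omega)
    have hw₀l : N.layer w₀ = j + 1 := by rw [N.layer_of_edge a w₀ haw₀, hal]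
    have hparents : ∀ w, N.layer w = j + 1 → N.Reaches w v →
        N.parents w = {u | N.layer u = j ∧ N.Reaches u v} := by
      intro w hwl hw
      ext u
      refine ⟨fun (hu : N.edge u w) => ⟨?_, hw.head hu⟩, fun hu => hall w hwl hw u hu.1 hu.2⟩
      have := N.layer_of_edge u w hu
      omega
    -- The nodes of layer `j + 1` that reach `v` are thus clones of one another and form a cut in a
    -- layer before the critical one.
    have hcut : N.IsVertexCut (N.clones w₀) {N.s 0, N.s 1} {N.d i} := by
      refine hv.1.trans (fun a ha => ?_) fun t ht => ?_
      · rcases ha with rfl | rfl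
        · exact ⟨0, rfl⟩
        · exact ⟨1, rfl⟩
      · rintro s ⟨hs, hsT⟩ t' ⟨rfl, htT⟩ hst
        have hsl : N.layer s = 0 := by
          rcases hs with rfl | rfl <;> exact layer_source _
        have htl := layer_eq_of_mem_clones ht
        obtain ⟨c, hcl, hsc, hct⟩ := exists_mem_layer_of_path (N := N) (fun _ _ h => h.1) hst
          (m := j + 1) (by omega) (by omega)
        have hcv : N.Reaches c v := by
          rcases Relation.ReflTransGen.cases_tail hct with h | ⟨p, hcp, hpt⟩
          · rw [h] at htl
            omega
          · exact (reaches_of_avoiding hcp).tail ((edge_iff_of_mem_clones ht).1 hpt.1)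
        refine notMem_of_avoiding hsT hsc (Or.inr ⟨?_, ?_, ?_⟩)
        · rw [isSource_iff]; omega
        · rw [isSource_iff]; omega
        · rw [hparents c hcl hcv, hparents w₀ hw₀l hw₀]
    have hle : N.criticalLayer i ≤ j + 1 := Nat.sInf_le ⟨w₀, hw₀l, hcut⟩
    have := hv.2
    omega

end GenericCoding

end LayeredNetwork

namespace LayeredNetwork

variable {V : Type*} {N : LayeredNetwork V} [Fintype V]

/-! ### Cancelling the interference at a critical node -/

section Neutralization

open MvPolynomial (X aeval supported)

/-- The parents of a node can cancel the symbol of the first source at the node, while the second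
one gets through, and so does the first one at a node of the same layer that is reached by the
first source only and does not have the same parents reachable from this source. -/
theorem exists_neutralizing_coefficients {v w a b : V} (ha : N.edge a v) (hb : N.edge b v)
    (hab : N.genericDet a b ≠ 0) (hwv : N.layer w = N.layer v)
    (h0w : N.Reaches (N.s 0) w) (h1w : ¬ N.Reaches (N.s 1) w)
    (hne : N.parentsFrom 0 w ≠ N.parentsFrom 0 v) :
    ∃ p : V → MvPolynomial V (ZMod 2),
      (∀ z, p z ∈ supported (ZMod 2) {u | N.layer u + 1 < N.layer v}) ∧
      ∀ g : V → MvPolynomial V (ZMod 2), (∀ z, N.edge z v → g z = p z) →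
        (∀ z, ¬ N.edge z v → g z = X z) →
        N.gain g 0 v = 0 ∧ N.gain g 1 v ≠ 0 ∧ N.gain g 0 w ≠ 0 := by
  classical
  have hv : ¬ N.IsSource v := not_isSource_of_edge ha
  have hw : ¬ N.IsSource w := by rwa [isSource_iff, hwv, ← isSource_iff]
  -- the coefficients cancel the symbol from `u₁` against that from `u₂`
  let c : V → V → V → ZMod 2 → V → MvPolynomial V (ZMod 2) := fun u₁ u₂ u₃ e z =>
    (if z = u₁ then N.genericGain 0 u₂ else 0) + (if z = u₂ then N.genericGain 0 u₁ else 0) +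
      (if z = u₃ then MvPolynomial.C e else 0)
  -- The parents of `v` lie one layer before it, so the shift by one confines their coefficients to
  -- layers strictly before their own.
  have hc : ∀ u₁ u₂ u₃ e, N.edge u₁ v → N.edge u₂ v →
      ∀ z, c u₁ u₂ u₃ e z ∈ supported (ZMod 2) {u | N.layer u + 1 < N.layer v} := by
    intro u₁ u₂ u₃ e h1 h2 z
    have hmem : ∀ u, N.edge u v →
        N.genericGain 0 u ∈ supported (ZMod 2) {u | N.layer u + 1 < N.layer v} := by
      intro u hu
      refine gain_mem_supported 0 fun y hy => MvPolynomial.X_mem_supported.2 ?_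
      have := N.layer_of_edge u v hu
      change N.layer y + 1 < N.layer v
      omega
    refine add_mem (add_mem ?_ ?_) ?_
    · split_ifs
      · exact hmem _ h2
      · exact zero_mem _
    · split_ifs
      · exact hmem _ h1
      · exact zero_mem _
    · split_ifs
      · exact Subalgebra.algebraMap_mem _ e
      · exact zero_mem _
  have hgen : ∀ g : V → MvPolynomial V (ZMod 2),
      (∀ z, ¬ N.edge z v → g z = X z) → ∀ i z, N.layer z + 1 = N.layer v →
        N.gain g i z = N.genericGain i z := by
    intro g hX i z hz
    refine gain_congr i fun y hy => hX y fun hyv => ?_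
    have := N.layer_of_edge y v hyv
    omega
  have hvgain : ∀ u₁ u₂ u₃ e, N.edge u₁ v → N.edge u₂ v → N.edge u₃ v →
      ∀ g : V → MvPolynomial V (ZMod 2), (∀ z, N.edge z v → g z = c u₁ u₂ u₃ e z) →
      (∀ z, ¬ N.edge z v → g z = X z) → ∀ i, N.gain g i v =
        N.genericGain 0 u₂ * N.genericGain i u₁ + N.genericGain 0 u₁ * N.genericGain i u₂ +
          MvPolynomial.C e * N.genericGain i u₃ := by
    intro u₁ u₂ u₃ e h1 h2 h3 g hg hX i
    have l1 := N.layer_of_edge _ _ h1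
    have l2 := N.layer_of_edge _ _ h2
    have l3 := N.layer_of_edge _ _ h3
    have hl := hgen g hX i
    rw [gain_eq_of_three hv hg i, if_pos h1, if_pos h2, if_pos h3, hl u₁ l1.symm, hl u₂ l2.symm,
      hl u₃ l3.symm]
  have hadd : ∀ q : MvPolynomial V (ZMod 2), q + q = 0 := fun q => CharTwo.add_self_eq_zero q
  have hpw : ∀ z, N.edge z w → N.Reaches (N.s 0) z := by
    intro z hz
    obtain ⟨i, hi⟩ := N.reached z
    obtain rfl | rfl : i = 0 ∨ i = 1 := by omega
    · exact hi
    · exact absurd (hi.tail hz) h1w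
  have hpw1 : ∀ z, N.edge z w → N.genericGain 1 z = 0 := fun z hz =>
    gain_eq_zero_of_not_reaches _ fun h => h1w (h.tail hz)
  by_cases hsub : ∀ z, N.edge z w → N.edge z v
  · -- some parent of `v` that is reached by the first source is not a parent of `w`
    obtain ⟨q, hqv, hq0, hqw⟩ : ∃ q, N.edge q v ∧ N.Reaches (N.s 0) q ∧ ¬ N.edge q w := by
      by_contra! h
      exact hne (Set.ext fun z => ⟨fun hz => ⟨hsub z hz.1, hz.2⟩, fun hz =>
        ⟨h z hz.1 hz.2, hz.2⟩⟩)
    obtain ⟨w₀, hw₀, hw₀s⟩ := exists_edge_of_not_isSource h0w hw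
    -- Here `q` is cancelled against `w₀` at `v`, but `w` hears only `w₀`, so symbol `0` survives
    -- there. The node `u` can inject symbol `1` at `v` if `q` does not carry it.
    have hfinish : ∀ q u e, N.edge q v → ¬ N.edge q w → N.Reaches (N.s 0) q → N.edge u v →
        ¬ N.edge u w → MvPolynomial.C e * N.genericGain 0 u = 0 →
        N.genericGain 0 w₀ * N.genericGain 1 q + MvPolynomial.C e * N.genericGain 1 u ≠ 0 →
        ∃ p : V → MvPolynomial V (ZMod 2),
          (∀ z, p z ∈ supported (ZMod 2) {u | N.layer u + 1 < N.layer v}) ∧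
          ∀ g : V → MvPolynomial V (ZMod 2), (∀ z, N.edge z v → g z = p z) →
            (∀ z, ¬ N.edge z v → g z = X z) →
            N.gain g 0 v = 0 ∧ N.gain g 1 v ≠ 0 ∧ N.gain g 0 w ≠ 0 := by
      intro q u e hqv hqw hq0 huv huw he0 he1
      refine ⟨c q w₀ u e, hc q w₀ u e hqv (hsub _ hw₀), fun g hg hX => ⟨?_, ?_, ?_⟩⟩
      · rw [hvgain q w₀ u e hqv (hsub _ hw₀) huv g hg hX 0, he0, add_zero, mul_comm, hadd]
      · rw [hvgain q w₀ u e hqv (hsub _ hw₀) huv g hg hX 1, hpw1 w₀ hw₀, mul_zero, add_zero]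
        exact he1
      · have hl := hgen g hX 0 w₀
          (by rw [N.layer_of_edge _ _ hw₀] at hwv; exact hwv)
        rw [gain_eq_of_three hw (fun z hz => hg z (hsub z hz)) 0, if_neg hqw, if_pos hw₀,
          if_neg huw, zero_add, add_zero, hl]
        exact mul_ne_zero (genericGain_ne_zero hq0) (genericGain_ne_zero hw₀s)
    obtain ⟨u, huv, hu1⟩ : ∃ u, N.edge u v ∧ N.genericGain 1 u ≠ 0 := by
      by_contra! h
      refine hab ?_
      rw [genericDet, h a ha, h b hb, mul_zero, zero_mul, sub_zero]
    have huw : ¬ N.edge u w := fun h => hu1 (hpw1 u h)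
    have hw₀' := genericGain_ne_zero hw₀s
    -- If `u` carries both symbols it serves as `q`. If it carries only symbol `1`, it is switched
    -- on with `e = 1` exactly when `q` lacks that symbol.
    by_cases hu0 : N.Reaches (N.s 0) u
    · refine hfinish u u 0 huv huw hu0 huv huw (by simp) ?_
      simpa using ⟨hw₀', hu1⟩
    · have hu0' : N.genericGain 0 u = 0 := gain_eq_zero_of_not_reaches _ hu0
      by_cases hq1 : N.genericGain 1 q = 0
      · refine hfinish q u 1 hqv hqw hq0 huv huw (by simp [hu0']) ?_
        simpa [hq1] using hu1
      · refine hfinish q u 0 hqv hqw hq0 huv huw (by simp) ?_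
        simpa using ⟨hw₀', hq1⟩
  · -- some parent of `w` is free to send at random
    push Not at hsub
    obtain ⟨u₀, hu₀w, hu₀v⟩ := hsub
    refine ⟨c a b a 0, hc a b a 0 ha hb, fun g hg hX => ⟨?_, ?_, ?_⟩⟩
    · rw [hvgain a b a 0 ha hb ha g hg hX 0, map_zero, zero_mul, add_zero, mul_comm, hadd]
    · rw [hvgain a b a 0 ha hb ha g hg hX 1, map_zero, zero_mul, add_zero]
      -- In characteristic two this gain is the determinant of `a` and `b`.
      intro h
      refine hab ?_
      rw [genericDet, sub_eq_add_neg, CharTwo.neg_eq, ← h]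
      ring
    · have hlw := N.layer_of_edge _ _ hu₀w
      -- `φ t` sets the free coefficient of `u₀` to `t`. The gain at `w` changes between `t = 0` and
      -- `t = 1` by the nonzero generic gain of `u₀`, so it is not zero.
      let φ : MvPolynomial V (ZMod 2) → MvPolynomial V (ZMod 2) →ₐ[ZMod 2] MvPolynomial V (ZMod 2) :=
        fun t => aeval fun z => if z = u₀ then t else X z
      have hφ : ∀ t, N.gain (fun z => φ t (g z)) 0 w = φ t (N.gain g 0 w) :=
        fun t => (map_gain (φ t).toRingHom g 0 w).symm
      have hφX : ∀ t z, φ t (X z) = if z = u₀ then t else X z := fun t z =>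
        MvPolynomial.aeval_X _ z
      have hφl : ∀ t z, N.edge z w → N.gain (fun z => φ t (g z)) 0 z = N.genericGain 0 z := by
        intro t z hz
        have hzl := N.layer_of_edge z w hz
        refine gain_congr 0 fun y hy => ?_
        have hy' : ¬ N.edge y v := fun h => by
          have := N.layer_of_edge y v h
          omega
        rw [hX y hy', hφX, if_neg]
        rintro rfl
        omega
      have hφg : ∀ t z, z ≠ u₀ → φ t (g z) = g z := by
        intro t z hz
        by_cases hzv : N.edge z v
        · rw [hg z hzv]
          refine algHom_eq_of_mem_supported (ψ := AlgHom.id _ _) (fun y hy => ?_)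
            (hc a b a 0 ha hb z)
          rw [hφX, if_neg]
          · rfl
          · rintro rfl
            change N.layer y + 1 < N.layer v at hy
            omega
        · rw [hX z hzv, hφX, if_neg hz]
      have hdiff : φ 1 (N.gain g 0 w) - φ 0 (N.gain g 0 w) = N.genericGain 0 u₀ := by
        rw [← hφ, ← hφ, gain_of_not_isSource _ _ hw, gain_of_not_isSource _ _ hw,
          ← Finset.sum_sub_distrib, Finset.sum_eq_single u₀]
        · rw [if_pos hu₀w, if_pos hu₀w, hφl _ _ hu₀w, hφl _ _ hu₀w, hX u₀ hu₀v, hφX, hφX,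
            if_pos rfl, if_pos rfl, one_mul, zero_mul, sub_zero]
        · intro z _ hz
          split_ifs with hzw
          · rw [hφl _ _ hzw, hφl _ _ hzw, hφg _ z hz, hφg _ z hz, sub_self]
          · exact sub_zero _
        · exact fun h => absurd (Finset.mem_univ _) h
      intro h
      rw [h, map_zero, map_zero, sub_zero] at hdiff
      exact genericGain_ne_zero (hpw u₀ hu₀w) hdiff.symm

/-- If a critical node of the second destination is not omniscient, then its parents can neutralize
the interference. -/
theorem randomLinearCoding_of_not_isOmniscient (hreach : ∀ i, N.Reaches (N.s i) (N.d i))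
    (h10 : ¬ N.Reaches (N.s 1) (N.d 0)) (hpos : 0 < N.criticalLayer 1) {v : V}
    (hv : N.IsCritical 1 v) (hno : ¬ N.IsOmniscient v) :
    N.RandomLinearCodingAchievesOneOne (N.parents v) := by
  classical
  have h01 : N.Reaches (N.s 0) (N.d 1) := by
    by_contra h
    exact hpos.ne' ((criticalLayer_eq_zero_iff (by decide) (hreach 1)).2 h)
  have hvl : 0 < N.layer v := by rw [hv.2]; exact hpos
  have hvs : ¬ N.IsSource v := by rw [isSource_iff]; omega
  have hsd : ∀ i, N.Reaches (N.s i) (N.d 1) := fun i => by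
    obtain rfl | rfl : i = 0 ∨ i = 1 := by omega
    · exact h01
    · exact hreach 1
  have hs : ∀ i, N.Reaches (N.s i) v := by
    intro i
    obtain ⟨u, hu, hiu, -⟩ := hv.1.exists_mem (source_mem_pair i) (hsd i)
    obtain ⟨z, hz, hiz⟩ := exists_edge_of_not_isSource hiu (not_isSource_of_mem_clones hu hvs)
    exact hiz.tail ((edge_iff_of_mem_clones hu).1 hz)
  obtain ⟨a, b, hal, hbl, hav, hbv, hab⟩ :=
    hv.exists_genericDet_ne_zero hs (j := N.layer v - 1) (by omega)
  have hedge : ∀ z, N.layer z = N.layer v - 1 → N.Reaches z v → N.edge z v := by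
    intro z hz hzv
    obtain ⟨y, hzy, hyv⟩ := exists_child hzv (by omega)
    have := N.layer_of_edge z y hzy
    rwa [← hyv.eq_of_layer_eq (by omega)]
  have hcut : ¬ N.IsVertexCut (N.clonesFrom 0 v) {N.s 0} {N.d 0} :=
    fun h => hno (Or.inr ⟨hv.1, h⟩)
  simp only [IsVertexCut, not_forall, not_not] at hcut
  obtain ⟨_, ⟨rfl, hsT⟩, _, ⟨rfl, -⟩, hpath⟩ := hcut
  -- The path avoiding the `s 0`-clones of `v` supplies `w`; since `w` reaches `d 0`, it is free of
  -- symbol `1`.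
  obtain ⟨w, hwl, hsw, hwd⟩ := exists_mem_layer_of_path (N := N) (fun _ _ h => h.1) hpath
    (m := N.layer v) (by rw [layer_source]; omega) (by rw [layer_dest]; exact N.layer_le v)
  have hwT := notMem_of_avoiding hsT hsw
  have h0w := reaches_of_avoiding hsw
  have hwd0 := reaches_of_avoiding hwd
  have h1w : ¬ N.Reaches (N.s 1) w := fun h => h10 (h.trans hwd0)
  have hws : ¬ N.IsSource w := by rw [isSource_iff]; omega
  have hne : N.parentsFrom 0 w ≠ N.parentsFrom 0 v := fun h => hwT (Or.inr ⟨hws, hvs, h⟩)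
  obtain ⟨p, hp, hpg⟩ := exists_neutralizing_coefficients (hedge a hal hav) (hedge b hbl hbv) hab
    hwl h0w h1w hne
  -- Off the parents of `v` the value is irrelevant, and zero meets the causality condition demanded
  -- at every node.
  let p' : V → MvPolynomial V (ZMod 2) := fun z => if N.edge z v then p z else 0
  let g : V → MvPolynomial V (ZMod 2) := fun z => if N.edge z v then p z else X z
  obtain ⟨hg0, hg1, hgw⟩ := hpg g (fun z hz => if_pos hz) (fun z hz => if_neg hz)
  have hlow : ∀ z, N.layer z < N.layer v →
      g z ∈ supported (ZMod 2) {u | N.layer u < N.layer v} := by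
    intro z hz
    by_cases hzv : N.edge z v
    · rw [show g z = p z from if_pos hzv]
      refine MvPolynomial.supported_mono (fun u hu => ?_) (hp z)
      change N.layer u + 1 < N.layer v at hu
      change N.layer u < N.layer v
      omega
    · rw [show g z = X z from if_neg hzv]
      exact MvPolynomial.X_mem_supported.2 hz
  have hhigh : ∀ z, N.layer v ≤ N.layer z → g z = X z := by
    intro z hz
    refine if_neg fun hzv => ?_
    have := N.layer_of_edge z v hzv
    omega
  have hclone : ∀ i u, u ∈ N.clones v → N.gain g i u = N.gain g i v := fun i u hu =>
    gain_eq_of_parents_eq g i (not_isSource_of_mem_clones hu hvs) hvs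
      fun z => edge_iff_of_mem_clones hu
  refine randomLinearCoding_of_polynomial (p := p') (g := g) (fun z => ?_)
    (fun z (hz : N.edge z v) => ?_) (fun z (hz : ¬ N.edge z v) => if_neg hz) ?_ ?_ ?_ ?_
  · by_cases hzv : N.edge z v
    · rw [show p' z = p z from if_pos hzv]
      refine MvPolynomial.supported_mono (fun u hu => ?_) (hp z)
      have hz := N.layer_of_edge z v hzv
      change N.layer u + 1 < N.layer v at hu
      refine ⟨fun (huv : N.edge u v) => ?_, by omega⟩
      have := N.layer_of_edge u v huv
      omega
    · rw [show p' z = 0 from if_neg hzv]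
      exact zero_mem _
  · exact (if_pos hz).trans (if_pos hz).symm
  · exact gain_ne_zero_of_reaches hwd0 (by rwa [hwl]) (by rwa [hwl]) hgw
  · exact gain_eq_zero_of_not_reaches g h10
  · refine hv.1.induction (P := fun u => N.gain g 0 u = 0) (fun u hu => (hclone 0 u hu).trans hg0)
      (fun i hi => absurd (source_mem_pair i) hi) fun u hu ih => ?_
    rw [gain_of_not_isSource g 0 hu]
    refine Finset.sum_eq_zero fun z _ => ?_
    split_ifs with hz
    · rw [ih z hz, mul_zero]
    · rfl
  · obtain ⟨u, hu, -, hud⟩ := hv.1.exists_mem (source_mem_pair 1) (hreach 1)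
    have hul := layer_eq_of_mem_clones hu
    exact gain_ne_zero_of_reaches hud (by rwa [hul]) (by rwa [hul]) (by rwa [hclone 1 u hu])

end Neutralization

end LayeredNetwork

/-! ### The main theorem -/

theorem mainTheorem5 {V : Type*} [Fintype V] (N : LayeredNetwork V)
    (hreach : ∀ i, N.Reaches (N.s i) (N.d i)) :
    (N.criticalLayer 0 = 0 ↔ ¬ N.Reaches (N.s 1) (N.d 0)) ∧
    (¬ N.Reaches (N.s 1) (N.d 0) →
      ((∃ v, N.IsOmniscient v) → N.capacityRegion = triangleRegion) ∧
      ((¬ ∃ v, N.IsOmniscient v) → N.capacityRegion = squareRegion ∧ N.Achievable (1, 1)) ∧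
      (∀ v₂, N.IsCritical 1 v₂ → ((∃ v, N.IsOmniscient v) ↔ N.IsOmniscient v₂)) ∧
      (N.criticalLayer 1 = 0 → N.RandomLinearCodingAchievesOneOne ∅) ∧
      (0 < N.criticalLayer 1 → (¬ ∃ v, N.IsOmniscient v) →
        ∀ v₂, N.IsCritical 1 v₂ → N.RandomLinearCodingAchievesOneOne (N.parents v₂))) := by
  refine ⟨LayeredNetwork.criticalLayer_eq_zero_iff (by decide) (hreach 0), fun h10 => ?_⟩
  have hzero : N.criticalLayer 1 = 0 → N.RandomLinearCodingAchievesOneOne ∅ := fun h =>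
    LayeredNetwork.randomLinearCoding_of_not_reaches hreach h10
      ((LayeredNetwork.criticalLayer_eq_zero_iff (by decide) (hreach 1)).1 h)
  have hach : ∀ v, N.IsCritical 1 v → ¬ N.IsOmniscient v → N.Achievable (1, 1) := by
    intro v hv hno
    rcases Nat.eq_zero_or_pos (N.criticalLayer 1) with h | h
    · exact LayeredNetwork.achievable_of_randomLinearCoding (hzero h)
    · exact LayeredNetwork.achievable_of_randomLinearCoding
        (LayeredNetwork.randomLinearCoding_of_not_isOmniscient hreach h10 h hv hno)
  refine ⟨fun ⟨v, hv⟩ => LayeredNetwork.capacityRegion_eq_triangleRegion hreach hv,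
    fun hno => ?_, fun v hv => ⟨fun ⟨u, hu⟩ => ?_, fun h => ⟨v, h⟩⟩, hzero,
    fun hpos hno v hv => LayeredNetwork.randomLinearCoding_of_not_isOmniscient hreach h10 hpos hv
      fun h => hno ⟨v, h⟩⟩
  · obtain ⟨v, hv⟩ := N.exists_isCritical 1
    have h := hach v hv fun h => hno ⟨v, h⟩
    exact ⟨LayeredNetwork.capacityRegion_eq_squareRegion h, h⟩
  -- No comparison of cuts is needed: achievability of `(1, 1)` from the critical node contradicts
  -- the sum-rate bound at `u`.
  · by_contra h
    exact LayeredNetwork.not_isOmniscient_of_achievable hreach (hach v hv h) u hu
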